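/- Let $n\ge 2$ and $k\ge 0$, and let $P_k^+$ be the set of dominant integral weights of $\widehat{\mathfrak{su}}(n)$ at level $k$, i.e. of tuples of Dynkin labels $\hat\mu=(m_1,\dots,m_n)\in\mathbb Z_{\ge0}^n$ with $\sum_i m_i=k$, where the label $n$ belongs to the affine node. Identify $\hat\mu$ with the partition $\mu=(\mu_1,\dots,\mu_{n-1})$ with $\mu_1\le k$ and $\mu_i-\mu_{i+1}=m_i$ for $1\le i\le n-1$ (where $\mu_n=0$); write $\hat\lambda\in P_k^+$ for the weight of such a partition $\lambda$. Let $S$ be the modular matrix $$S_{\hat\lambda\hat\sigma}=\frac{e^{i\pi n(n-1)/4}}{\sqrt{n(k+n)^{n-1}}}\sum_{w\in S_n}(-1)^{\ell(w)}e^{-\frac{2\pi i}{k+n}(\sigma+\rho,\,w(\lambda+\rho))},$$ where $\rho$ is the Weyl vector of $\mathfrak{su}(n)$ and $\lambda,\sigma$ denote the finite parts of the weights, and let the fusion coefficients at level $k$ be defined by the Verlinde formula $$\mathcal N^{(k),\hat\nu}_{\hat\lambda\hat\mu}=\sum_{\hat\sigma\in P_k^+}\frac{S_{\hat\lambda\hat\sigma}S_{\hat\mu\hat\sigma}S^{-1}_{\hat\nu\hat\sigma}}{S_{\hat\emptyset\hat\sigma}}.$$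 Let $\varphi_i^*:P_k^+\to P_{k+1}^+$ raise the label $m_i$ by one, and let $\varphi_i$ lower $m_i>0$ by one and send a weight with $m_i=0$ to $0$. A fusion coefficient one of whose arguments is $0$ is $0$. For a partition $\lambda$ with at most $n$ parts let $\lambda'$ be the partition obtained by deleting all columns of height $n$ from its Young diagram. A skew diagram $\lambda/\mu$ (with $\mu\subseteq\lambda$) is a vertical (horizontal) $r$-strip if it consists of $r$ boxes, no two of which are in the same row (column). Proposition. Let $\hat\mu,\hat\nu\in P_k^+$. (a) Let $0\le r\le n-1$, where $k\ge1$ if $r>0$. Then $\mathcal N^{(k),\hat\nu}_{\widehat{(1^r)}\,\hat\mu}=1$ if one of the following two conditions holds, and $\mathcal N^{(k),\hat\nu}_{\widehat{(1^r)}\,\hat\mu}=0$ otherwise. 1. There is a partition $\lambda$ with at most $n$ parts and $\lambda_1\le k$ such that $\lambda'=\nu$, $\lambda_1=\mu_1$ and $\lambda/\mu$ is a vertical $r$-strip. 2. $r\ge1$, and there is a partition $\lambda$ with at most $n$ parts and $\lambda_1\le k+1$ such that $\lambda'$ is the partition of $\varphi_n^*\hat\nu$, $\lambda_1=\mu_1+1$,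 and $\lambda/\tilde\mu$ is a vertical $(r-1)$-strip, where $\tilde\mu$ is the partition of $\varphi_1^*\hat\mu$. (b) Let $0\le r\le k$. If there is a partition $\lambda$ with at most $n$ parts and $\lambda_1\le k$ such that $\lambda'=\nu$, $\lambda_1=\mu_1$ and $\lambda/\mu$ is a horizontal $r$-strip, then $\mathcal N^{(k),\hat\nu}_{\widehat{(r)}\,\hat\mu}=1$. Otherwise $$\mathcal N^{(k),\hat\nu}_{\widehat{(r)}\,\hat\mu}=\mathcal N^{(k-1),\varphi_1\hat\nu}_{\widehat{(r-1)}\,\varphi_n\hat\mu},$$ where the right-hand side is $0$ if $r=0$, $\varphi_n\hat\mu=0$ or $\varphi_1\hat\nu=0$. -/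

import Mathlib

noncomputable section

namespace SuFusion

/-- Dominant integral weights of affine `su(n)` at level `k`, given by their Dynkin labels:
`n`-tuples of non-negative integers with sum `k`. The node `i = 1, …, n` of the Dynkin diagram
is the index `i - 1` of `Fin n`; in particular the affine node `n` is the index `n - 1`. -/
abbrev Weight (n k : ℕ) : Type := {m : Fin n → ℕ // ∑ i, m i = k}

instance (n k : ℕ) : Fintype (Weight n k) :=
  Fintype.subtype (Finset.piAntidiag Finset.univ k) (fun m => by simp)

/-- The index of the node `1`. -/
def node1 (n : ℕ) [NeZero n] : Fin n := 0

/-- The index of the affine node `n`. -/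
def nodeN (n : ℕ) [NeZero n] : Fin n := ⟨n - 1, Nat.sub_lt (NeZero.pos n) one_pos⟩

/-- The operator `φ_i^*`, which raises the Dynkin label `m_i` by one. -/
def phiStar {n k : ℕ} (i : Fin n) (m : Weight n k) : Weight n (k + 1) :=
  ⟨fun j => if j = i then m.1 j + 1 else m.1 j, by
    have h : (fun j => if j = i then m.1 j + 1 else m.1 j)
        = fun j => m.1 j + if j = i then 1 else 0 := by
      funext j; split_ifs <;> rfl
    rw [h, Finset.sum_add_distrib, m.2]; simp⟩

/-- The operator `φ_i`, which lowers the Dynkin label `m_i` by one, on the weights with `m_i > 0`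
(it sends the other weights to the zero vector). -/
def phi {n k : ℕ} (i : Fin n) (m : Weight n k) (h : 0 < m.1 i) : Weight n (k - 1) :=
  ⟨fun j => if j = i then m.1 j - 1 else m.1 j, by
    have h1 : (∑ j, if j = i then m.1 j - 1 else m.1 j) + 1 = k := by
      have h2 : (∑ j, ((if j = i then m.1 j - 1 else m.1 j) + if j = i then 1 else 0)) = k := by
        refine (Finset.sum_congr rfl fun j _ => ?_).trans m.2
        split_ifs with hj
        · subst hj; omega
        · rfl
      rw [Finset.sum_add_distrib] at h2
      simpa using h2
    exact Nat.eq_sub_of_add_eq h1⟩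

/-- The part `λ_{i+1} = m_{i+1} + ⋯ + m_{n-1}` of the partition of a weight, so that
`λ_i - λ_{i+1} = m_i` for `1 ≤ i ≤ n - 1` and `λ_n = λ_{n+1} = ⋯ = 0`. -/
def part {n k : ℕ} (m : Weight n k) (i : ℕ) : ℕ :=
  ∑ j : Fin n with i ≤ j.1 ∧ j.1 + 1 < n, m.1 j

theorem part_anti {n k : ℕ} (m : Weight n k) {i i' : ℕ} (h : i ≤ i') : part m i' ≤ part m i := by
  apply Finset.sum_le_sum_of_subset
  intro j
  simp only [Finset.mem_filter, Finset.mem_univ, true_and]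
  omega

/-- The partition (Young diagram) `λ` of the weight `λ̂`. -/
def diagram {n k : ℕ} (m : Weight n k) : YoungDiagram where
  cells := (Finset.range n ×ˢ Finset.range (part m 0)).filter fun c => c.2 < part m c.1
  isLowerSet := by
    rintro ⟨i, j⟩ ⟨i', j'⟩ hle hmem
    simp only [Prod.mk_le_mk] at hle
    simp only [Finset.coe_filter, Finset.mem_product, Finset.mem_range, Set.mem_ofPred_eq]
      at hmem ⊢
    have h1 := part_anti m hle.1
    omega

/-- The weight `λ̂` at level `k` of a partition `λ` with fewer than `n` rows and at most `k` columns. -/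
def hat {n k : ℕ} (lam : YoungDiagram) (hn : lam.colLen 0 < n) (hk : lam.rowLen 0 ≤ k) :
    Weight n k :=
  ⟨fun i => if i.1 + 1 < n then lam.rowLen i.1 - lam.rowLen (i.1 + 1) else k - lam.rowLen 0, by
    obtain ⟨N, rfl⟩ : ∃ N, n = N + 1 := ⟨n - 1, by omega⟩
    rw [Fin.sum_univ_castSucc]
    have h0 : lam.rowLen N = 0 := by
      by_contra hne
      have := (YoungDiagram.mem_iff_lt_colLen (μ := lam) (i := N) (j := 0)).1
        (YoungDiagram.mem_iff_lt_rowLen.2 (Nat.pos_of_ne_zero hne))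
      omega
    have h1 : ∀ M, (∑ i ∈ Finset.range M, (lam.rowLen i - lam.rowLen (i + 1)))
        = lam.rowLen 0 - lam.rowLen M := by
      intro M
      induction M with
      | zero => simp
      | succ M ih =>
        rw [Finset.sum_range_succ, ih]
        have := lam.rowLen_anti M (M + 1) (by omega)
        have := lam.rowLen_anti 0 M (by omega)
        omega
    have h2 : (∑ i : Fin N, (lam.rowLen i.1 - lam.rowLen (i.1 + 1))) = lam.rowLen 0 := by
      rw [Fin.sum_univ_eq_sum_range (fun i => lam.rowLen i - lam.rowLen (i + 1)) N, h1, h0]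
      omega
    simp only [Fin.val_castSucc, Fin.val_last, Nat.add_lt_add_iff_right, Fin.is_lt, if_true,
      lt_irrefl, if_false, h2]
    omega⟩

theorem mem_diagram {n k : ℕ} {m : Weight n k} {i j : ℕ} :
    (i, j) ∈ diagram m ↔ j < part m i := by
  rw [← YoungDiagram.mem_cells]
  simp only [diagram, Finset.mem_filter, Finset.mem_product, Finset.mem_range]
  refine ⟨fun h => h.2, fun h => ⟨⟨?_, h.trans_le (part_anti m (Nat.zero_le i))⟩, h⟩⟩
  by_contra hi
  have h0 : part m i = 0 := by
    apply Finset.sum_eq_zero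
    intro a ha
    simp only [Finset.mem_filter, Finset.mem_univ, true_and] at ha
    omega
  omega

theorem rowLen_diagram {n k : ℕ} (m : Weight n k) (i : ℕ) : (diagram m).rowLen i = part m i := by
  apply le_antisymm
  · by_contra h
    exact lt_irrefl _ (mem_diagram.1 (YoungDiagram.mem_iff_lt_rowLen.2 (not_le.1 h)))
  · by_contra h
    exact lt_irrefl _ (YoungDiagram.mem_iff_lt_rowLen.1 (mem_diagram.2 (not_le.1 h)))

/-- The partition of the weight `λ̂` is `λ`. -/
theorem diagram_hat {n k : ℕ} (lam : YoungDiagram) (hn : lam.colLen 0 < n)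
    (hk : lam.rowLen 0 ≤ k) : diagram (hat (k := k) lam hn hk) = lam := by
  have h0 : ∀ i, n ≤ i + 1 → lam.rowLen i = 0 := by
    intro i hi
    by_contra hne
    have := (YoungDiagram.mem_iff_lt_colLen (μ := lam) (i := i) (j := 0)).1
      (YoungDiagram.mem_iff_lt_rowLen.2 (Nat.pos_of_ne_zero hne))
    omega
  have key : ∀ d i, n ≤ i + 1 + d → part (hat (k := k) lam hn hk) i = lam.rowLen i := by
    intro d
    induction d with
    | zero =>
      intro i hi
      rw [h0 i (by omega)]
      apply Finset.sum_eq_zero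
      intro a ha
      simp only [Finset.mem_filter, Finset.mem_univ, true_and] at ha
      omega
    | succ d ih =>
      intro i hi
      by_cases hi' : n ≤ i + 1 + d
      · exact ih i hi'
      · have h1 := ih (i + 1) (by omega)
        have h2 : part (hat (k := k) lam hn hk) i
            = (hat (k := k) lam hn hk).1 ⟨i, by omega⟩ + part (hat (k := k) lam hn hk) (i + 1) := by
          unfold part
          rw [← Finset.sum_insert (by simp)]
          refine Finset.sum_congr ?_ fun _ _ => rfl
          ext a
          simp only [Finset.mem_filter, Finset.mem_univ, true_and, Finset.mem_insert, Fin.ext_iff]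
          omega
        rw [h2, h1]
        have := lam.rowLen_anti i (i + 1) (by omega)
        simp only [hat]
        rw [if_pos (by omega)]
        omega
  ext ⟨i, j⟩
  rw [YoungDiagram.mem_cells, YoungDiagram.mem_cells, mem_diagram, key n i (by omega),
    YoungDiagram.mem_iff_lt_rowLen]

/-- The rectangular Young diagram with `a` rows and `b` columns. -/
def rect (a b : ℕ) : YoungDiagram where
  cells := Finset.range a ×ˢ Finset.range b
  isLowerSet := by
    rintro ⟨i, j⟩ ⟨i', j'⟩ hle hmem
    simp only [Prod.mk_le_mk] at hle
    simp only [Finset.coe_product, Finset.coe_range, Set.mem_prod, Set.mem_Iio] at hmem ⊢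
    omega

theorem mem_rect {a b : ℕ} {c : ℕ × ℕ} : c ∈ rect a b ↔ c.1 < a ∧ c.2 < b := by
  rw [← YoungDiagram.mem_cells]
  simp [rect]

theorem colLen_rect_le (a b : ℕ) : (rect a b).colLen 0 ≤ a := by
  by_contra h
  have := mem_rect.1 (YoungDiagram.mem_iff_lt_colLen.2 (not_le.1 h))
  simp at this

theorem rowLen_rect_le (a b : ℕ) : (rect a b).rowLen 0 ≤ b := by
  by_contra h
  have := mem_rect.1 (YoungDiagram.mem_iff_lt_rowLen.2 (not_le.1 h))
  simp at this

theorem rowLen_rect_zero (b : ℕ) : (rect 0 b).rowLen 0 = 0 := by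
  by_contra h
  have := mem_rect.1 (YoungDiagram.mem_iff_lt_rowLen.2 (Nat.pos_of_ne_zero h))
  simp at this

/-- The weight of the empty partition. -/
def emptyWeight (n k : ℕ) [NeZero n] : Weight n k :=
  hat (rect 0 0) ((colLen_rect_le 0 0).trans_lt (NeZero.pos n))
    ((rowLen_rect_le 0 0).trans (Nat.zero_le k))

/-- The weight of the column partition `(1^r)`, where `r < n`. -/
def columnWeight (n k r : ℕ) (hr : r < n) (hk : r = 0 ∨ 0 < k) : Weight n k :=
  hat (rect r 1) ((colLen_rect_le r 1).trans_lt hr) (by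
    rcases hk with rfl | hk
    · rw [rowLen_rect_zero]; exact Nat.zero_le k
    · exact (rowLen_rect_le r 1).trans hk)

/-- The weight of the row partition `(r)`, where `r ≤ k` and `n ≥ 2`. -/
def rowWeight (n k r : ℕ) (hn : 2 ≤ n) (hr : r ≤ k) : Weight n k :=
  hat (rect 1 r) ((colLen_rect_le 1 r).trans_lt hn) ((rowLen_rect_le 1 r).trans hr)

/-- The finite part of a weight, in the orthonormal coordinates of `ℝⁿ` in which the roots of `su(n)`
are `ε_i - ε_j`. -/
def finitePart {n k : ℕ} (m : Weight n k) (i : Fin n) : ℝ :=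
  part m i.1 - (∑ j : Fin n, (part m j.1 : ℝ)) / n

/-- The Weyl vector of `su(n)` in the same coordinates. -/
def weylVector (n : ℕ) (i : Fin n) : ℝ := ((n : ℝ) - 1) / 2 - i.1

/-- The modular `S`-matrix (Kac-Peterson formula); the Weyl group of `su(n)` is the group of
permutations of the coordinates, `w` sending the vector `v` to `i ↦ v (w⁻¹ i)`. -/
def modularS (n k : ℕ) : Matrix (Weight n k) (Weight n k) ℂ :=
  Matrix.of fun lam sig =>
    Complex.exp (Complex.I * Real.pi * n * (n - 1) / 4)
        / ((Real.sqrt ((n : ℝ) * ((k : ℝ) + n) ^ (n - 1)) : ℝ) : ℂ) *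
      ∑ w : Equiv.Perm (Fin n), ((Equiv.Perm.sign w : ℤ) : ℂ) *
        Complex.exp (-(2 * Real.pi * Complex.I / ((k : ℂ) + n)) *
          ((∑ i : Fin n, (finitePart sig i + weylVector n i) *
            (finitePart lam (w⁻¹ i) + weylVector n (w⁻¹ i)) : ℝ) : ℂ))

/-- The fusion coefficient of `λ̂`, `μ̂`, `ν̂` at level `k` (Verlinde formula). -/
def fusionCoeff {n k : ℕ} [NeZero n] (lam mu nu : Weight n k) : ℂ :=
  ∑ sig : Weight n k,
    modularS n k lam sig * modularS n k mu sig * (modularS n k)⁻¹ nu sig /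
      modularS n k (emptyWeight n k) sig

/-- The diagram `λ'` obtained from `λ` (with at most `n` rows) by deleting all columns of height `n`. -/
def deleteColumns (n : ℕ) (lam : YoungDiagram) : YoungDiagram where
  cells := lam.cells.filter fun c => (c.1, c.2 + lam.rowLen (n - 1)) ∈ lam
  isLowerSet := by
    rintro ⟨i, j⟩ ⟨i', j'⟩ hle hmem
    simp only [Prod.mk_le_mk] at hle
    simp only [Finset.coe_filter, Set.mem_ofPred_eq, YoungDiagram.mem_cells] at hmem ⊢
    exact ⟨lam.up_left_mem hle.1 hle.2 hmem.1, lam.up_left_mem hle.1 (by omega) hmem.2⟩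

/-- `λ` is a partition in the `n × k` bounding box with `λ' = ν`, where `ν` is the partition of `ν̂`.
That is, `λ` is `ν` up to columns of height `n`. -/
def Represents {n k : ℕ} (lam : YoungDiagram) (nu : Weight n k) : Prop :=
  lam.colLen 0 ≤ n ∧ lam.rowLen 0 ≤ k ∧ deleteColumns n lam = diagram nu

/-- `λ/μ` is a vertical strip of length `r`: it has `r` boxes, no two of them in the same row. -/
def IsVerticalStrip (r : ℕ) (lam mu : YoungDiagram) : Prop :=
  mu ≤ lam ∧ (lam.cells \ mu.cells).card = r ∧
    ∀ c ∈ lam.cells \ mu.cells, ∀ d ∈ lam.cells \ mu.cells, c.1 = d.1 → c = d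

/-- `λ/μ` is a horizontal strip of length `r`: it has `r` boxes, no two of them in the same column. -/
def IsHorizontalStrip (r : ℕ) (lam mu : YoungDiagram) : Prop :=
  mu ≤ lam ∧ (lam.cells \ mu.cells).card = r ∧
    ∀ c ∈ lam.cells \ mu.cells, ∀ d ∈ lam.cells \ mu.cells, c.2 = d.2 → c = d

/-- First case for columns: `λ_1 = μ_1` and `λ/μ` is a vertical `r`-strip,
for some `λ` that is `ν` up to `n`-columns. -/
def ColumnCase1 {n k : ℕ} (r : ℕ) (mu nu : Weight n k) : Prop :=
  ∃ lam : YoungDiagram, Represents lam nu ∧ lam.rowLen 0 = (diagram mu).rowLen 0 ∧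
    IsVerticalStrip r lam (diagram mu)

/-- Second case for columns: `λ_1 = μ_1 + 1` and `λ/φ_1^*μ` is a vertical `(r-1)`-strip,
for some `λ` that is `φ_n^*ν` up to `n`-columns. It never occurs for `r = 0`. -/
def ColumnCase2 {n k : ℕ} [NeZero n] (r : ℕ) (mu nu : Weight n k) : Prop :=
  ∃ lam : YoungDiagram, Represents lam (phiStar (nodeN n) nu) ∧
    lam.rowLen 0 = (diagram mu).rowLen 0 + 1 ∧
    ∃ s : ℕ, s + 1 = r ∧ IsVerticalStrip s lam (diagram (phiStar (node1 n) mu))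

/-- First case for rows: `λ_1 = μ_1` and `λ/μ` is a horizontal `r`-strip,
for some `λ` that is `ν` up to `n`-columns. -/
def RowCase {n k : ℕ} (r : ℕ) (mu nu : Weight n k) : Prop :=
  ∃ lam : YoungDiagram, Represents lam nu ∧ lam.rowLen 0 = (diagram mu).rowLen 0 ∧
    IsHorizontalStrip r lam (diagram mu)

end SuFusion

end

/-!
Up to a factor depending only on the column, the entries of a column of `S` are the alternants
`det (X i ^ (λ + ρ) j)` at `n` distinct points `X i` whose powers of exponent `k + n` all agree.
Expanding the product of such an alternant with an elementary symmetric polynomial gives the Pieri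
rule for vertical strips. As the exponents of `X i` matter only modulo `k + n`, up to a common
factor, the strips live on a cylinder whose `n` rows follow each other cyclically; an addition of
boxes that does not produce a diagram has two proportional columns and contributes nothing. The rule
for horizontal strips follows from it through the recursion between elementary and complete
symmetric polynomials.

So the rows of `S` diagonalize the multiplication by a column or a row simultaneously. The columns
have distinct eigenvalues, hence are independent, `S` is invertible, and the Verlinde formula reads
off the coefficients `0` and `1` of the two Pieri rules.

A cylindric strip is a strip of ordinary diagrams exactly if it puts no box in the first row. If it
does, the first box is shifted off: for columns by raising the first label of `μ` and the affine
label of `ν`, for rows by lowering the affine label of `μ` and the first label of `ν`.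
-/

namespace SuFusion

open Finset

section Boxes

variable {n : ℕ} [NeZero n]

theorem nodeN_add_one : nodeN n + 1 = 0 := by
  obtain ⟨N, rfl⟩ := Nat.exists_eq_succ_of_ne_zero (NeZero.ne n)
  exact Fin.last_add_one N

theorem add_one_eq_zero_iff {i : Fin n} : i + 1 = 0 ↔ i = nodeN n := by
  rw [← nodeN_add_one, add_left_inj]

open Fin.CommRing in
theorem cyclic_induction {p : Fin n → Prop} {a : Fin n} (base : p a)
    (step : ∀ i, p i → p (i + 1)) (i : Fin n) : p i := by
  have shifted : ∀ d : ℕ, p (a + d) := by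
    intro d
    induction d with
    | zero => simpa using base
    | succ d ih => simpa [add_assoc] using step _ ih
  simpa using shifted (i - a).val

theorem sum_add_one {M : Type*} [AddCommMonoid M] (f : Fin n → M) :
    ∑ i, f (i + 1) = ∑ i, f i :=
  Equiv.sum_comp (Equiv.addRight (1 : Fin n)) f

/-- Adding `b i` boxes to the row `i` of a cylindric diagram with labels `m`, where the rows follow
each other cyclically and the label `m i` is the overhang of the row `i` over the row `i + 1`,
gives a diagram with labels `l`. -/
def AddsBoxes (m b l : Fin n → ℕ) : Prop := ∀ i, l i + b (i + 1) = m i + b i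

/-- Adding `b i` boxes to the row `i` of a cylindric diagram with labels `m` gives a diagram. -/
def Addable (m b : Fin n → ℕ) : Prop := ∀ i, b (i + 1) ≤ m i + b i

instance (m b : Fin n → ℕ) : Decidable (Addable m b) :=
  inferInstanceAs (Decidable (∀ i, b (i + 1) ≤ m i + b i))

/-- The labels of the cylindric diagram with labels `m` after the addition of `b i` boxes to the
row `i`; the subtraction is truncated unless `Addable m b`. -/
def addBoxes (m b : Fin n → ℕ) (i : Fin n) : ℕ := m i + b i - b (i + 1)

variable {m l a b : Fin n → ℕ}

theorem AddsBoxes.addable (h : AddsBoxes m b l) : Addable m b :=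
  fun i => (Nat.le_add_left _ _).trans (h i).le

theorem addBoxes_eq_iff (h : Addable m b) : addBoxes m b = l ↔ AddsBoxes m b l := by
  refine funext_iff.trans (forall_congr' fun i => ?_)
  have := h i
  simp only [addBoxes]
  omega

theorem addsBoxes_addBoxes (h : Addable m b) : AddsBoxes m b (addBoxes m b) :=
  (addBoxes_eq_iff h).1 rfl

theorem AddsBoxes.sum_eq (h : AddsBoxes m b l) : ∑ i, l i = ∑ i, m i := by
  have := Fintype.sum_congr _ _ h
  rwa [sum_add_distrib, sum_add_distrib, sum_add_one, add_left_inj] at this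

theorem sum_addBoxes (h : Addable m b) : ∑ i, addBoxes m b i = ∑ i, m i :=
  (addsBoxes_addBoxes h).sum_eq

theorem addBoxes_zero (m : Fin n → ℕ) : addBoxes m 0 = m := by
  funext i
  simp [addBoxes]

theorem addable_addBoxes (h : Addable m a) : Addable (addBoxes m a) b ↔ Addable m (a + b) := by
  refine forall_congr' fun i => ?_
  have := h i
  simp only [addBoxes, Pi.add_apply]
  omega

theorem addBoxes_addBoxes (h : Addable m a) :
    addBoxes (addBoxes m a) b = addBoxes m (a + b) := by
  funext i
  have := h i
  simp only [addBoxes, Pi.add_apply]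
  omega

theorem AddsBoxes.boxes_unique (ha : AddsBoxes m a l) (hb : AddsBoxes m b l)
    (hab : ∑ i, a i = ∑ i, b i) : a = b := by
  have const : ∀ i, a i + b 0 = b i + a 0 := by
    refine cyclic_induction (add_comm _ _) fun i hi => ?_
    have := ha i
    have := hb i
    omega
  have h0 : n * b 0 = n * a 0 := by
    simpa [sum_add_distrib, hab] using Fintype.sum_congr _ _ const
  funext i
  have := const i
  have := Nat.eq_of_mul_eq_mul_left (NeZero.pos n) h0
  omega

end Boxes

section Strips

variable {n : ℕ} [NeZero n]

/-- The vertical strips of `r` boxes that can be added to a cylindric diagram with labels `m`. -/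
def verticalStrips (m : Fin n → ℕ) (r : ℕ) : Finset (Fin n → ℕ) :=
  {b ∈ piAntidiag univ r | (∀ i, b i ≤ 1) ∧ Addable m b}

/-- The horizontal strips of `r` boxes that can be added to a cylindric diagram with labels `m`. -/
def horizontalStrips (m : Fin n → ℕ) (r : ℕ) : Finset (Fin n → ℕ) :=
  {b ∈ piAntidiag univ r | ∀ i, b (i + 1) ≤ m i}

/-- The vertical strips `v` such that the boxes `b`, added to a cylindric diagram with labels `m`,
are those of `v` together with a horizontal strip `b - v`. -/
def splits (m b : Fin n → ℕ) : Finset (Fin n → ℕ) :=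
  Fintype.piFinset fun i => {x ∈ range 2 | x ≤ b i ∧ b i - x ≤ m (i - 1)}

variable {m a b v : Fin n → ℕ} {r : ℕ}

theorem mem_verticalStrips :
    b ∈ verticalStrips m r ↔ ∑ i, b i = r ∧ (∀ i, b i ≤ 1) ∧ Addable m b := by
  simp [verticalStrips]

theorem mem_horizontalStrips :
    b ∈ horizontalStrips m r ↔ ∑ i, b i = r ∧ ∀ i, b (i + 1) ≤ m i := by
  simp [horizontalStrips]

theorem addable_of_mem_verticalStrips (h : b ∈ verticalStrips m r) : Addable m b :=
  (mem_verticalStrips.1 h).2.2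

theorem addable_of_mem_horizontalStrips (h : b ∈ horizontalStrips m r) : Addable m b :=
  fun i => ((mem_horizontalStrips.1 h).2 i).trans (Nat.le_add_right _ _)

theorem mem_splits :
    v ∈ splits m b ↔ (∀ i, v i ≤ 1) ∧ v ≤ b ∧ ∀ i, (b - v) (i + 1) ≤ m i := by
  have shift : (∀ i, b i - v i ≤ m (i - 1)) ↔ ∀ i, (b - v) (i + 1) ≤ m i := by
    simpa using ((Equiv.addRight (1 : Fin n)).forall_congr_right
      (q := fun i => b i - v i ≤ m (i - 1))).symm
  simp only [splits, Fintype.mem_piFinset, mem_filter, mem_range, Nat.lt_succ_iff, forall_and,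
    shift, Pi.le_def]

theorem sum_le_of_mem_splits (h : v ∈ splits m b) : ∑ i, v i ≤ ∑ i, b i :=
  sum_le_sum fun i _ => (mem_splits.1 h).2.1 i

theorem exists_unforced_row (h : Addable m b) (hpos : 0 < ∑ i, b i)
    (hlt : ∑ i, b i < ∑ i, m i + n) : ∃ j, b j ≠ 0 ∧ b j ≠ m (j - 1) + 1 := by
  by_contra! full
  by_cases empty_row : ∃ j, b j = 0
  · obtain ⟨j, hj⟩ := empty_row
    have all_empty : ∀ i, b i = 0 := by
      refine cyclic_induction hj fun i hi => ?_
      by_contra hne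
      have := full _ hne
      rw [add_sub_cancel_right] at this
      have := h i
      omega
    simp [all_empty] at hpos
  · push Not at empty_row
    have : ∀ i, b (i + 1) = m i + 1 := fun i => by simpa using full (i + 1) (empty_row _)
    have := Fintype.sum_congr _ _ this
    simp [sum_add_one, sum_add_distrib] at this
    omega

/-- The sign factors over the rows, and it cancels in each row where the choice between a box of the
vertical strip and none is free, or leaves nothing. -/
theorem sum_sign_splits (R : Type*) [CommRing R] (h : Addable m b) (hpos : 0 < ∑ i, b i)
    (hlt : ∑ i, b i < ∑ i, m i + n) : ∑ v ∈ splits m b, (-1 : R) ^ ∑ i, v i = 0 := by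
  obtain ⟨j, hj, hj'⟩ := exists_unforced_row h hpos hlt
  simp_rw [← prod_pow_eq_pow_sum]
  rw [splits, ← prod_univ_sum]
  refine prod_eq_zero (mem_univ j) ?_
  simp only [sum_filter, sum_range_succ, range_zero, sum_empty]
  split_ifs <;> first | omega | simp

end Strips

section Pieri

variable {n : ℕ} [NeZero n] {R : Type*} [CommRing R]

/-- `F` satisfies the Pieri rule for vertical strips at level `k`, with multipliers `e`. -/
def VerticalPieri (k : ℕ) (e : ℕ → R) (F : (Fin n → ℕ) → R) : Prop :=
  ∀ m : Fin n → ℕ, ∑ i, m i = k → ∀ r, e r * F m = ∑ b ∈ verticalStrips m r, F (addBoxes m b)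

/-- The sum of `F` over all diagrams that arise from the diagram with labels `m` by adding a
horizontal strip of `r` boxes. -/
def stripSum (F : (Fin n → ℕ) → R) (r : ℕ) (m : Fin n → ℕ) : R :=
  ∑ b ∈ horizontalStrips m r, F (addBoxes m b)

theorem stripSum_zero (F : (Fin n → ℕ) → R) (m : Fin n → ℕ) : stripSum F 0 m = F m := by
  simp [stripSum, horizontalStrips, filter_singleton, addBoxes_zero]

theorem sum_horizontal_vertical (F : (Fin n → ℕ) → R) (m : Fin n → ℕ) (i j : ℕ) :
    ∑ a ∈ horizontalStrips m j, ∑ v ∈ verticalStrips (addBoxes m a) i,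
        F (addBoxes (addBoxes m a) v) =
      ∑ b ∈ piAntidiag univ (i + j) with Addable m b,
        ∑ v ∈ splits m b with ∑ t, v t = i, F (addBoxes m b) := by
  rw [sum_sigma', sum_sigma']
  refine sum_bij' (fun p _ => ⟨p.1 + p.2, p.2⟩) (fun p _ => ⟨p.1 - p.2, p.2⟩) ?_ ?_ ?_ ?_ ?_
  · rintro ⟨a, v⟩ h
    obtain ⟨ha, hv⟩ := mem_sigma.1 h
    obtain ⟨sum_v, v_le, addable⟩ := mem_verticalStrips.1 hv
    rw [addable_addBoxes (addable_of_mem_horizontalStrips ha)] at addable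
    obtain ⟨sum_a, ha⟩ := mem_horizontalStrips.1 ha
    simp [mem_splits, sum_add_distrib, sum_a, sum_v, v_le, addable, add_comm j, ha]
  · rintro ⟨b, v⟩ h
    simp only [mem_sigma, mem_filter, mem_piAntidiag, mem_splits] at h
    obtain ⟨⟨⟨sum_b, -⟩, addable⟩, ⟨v_le, v_le_b, rest⟩, sum_v⟩ := h
    have sum_sub : ∑ t, (b - v) t = j := by
      rw [sum_congr rfl fun t _ => Pi.sub_apply b v t, sum_tsub_distrib univ fun t _ => v_le_b t,
        sum_v]
      exact Nat.sub_eq_of_eq_add' sum_b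
    have strip : b - v ∈ horizontalStrips m j := mem_horizontalStrips.2 ⟨sum_sub, rest⟩
    refine mem_sigma.2 ⟨strip, mem_verticalStrips.2 ⟨sum_v, v_le, ?_⟩⟩
    rw [addable_addBoxes (addable_of_mem_horizontalStrips strip)]
    simpa only [tsub_add_cancel_of_le v_le_b] using addable
  · rintro ⟨a, v⟩ -
    simp
  · rintro ⟨b, v⟩ h
    simp only [mem_sigma, mem_filter, mem_splits] at h
    simp only [tsub_add_cancel_of_le h.2.1.2.1]
  · rintro ⟨a, v⟩ h
    rw [addBoxes_addBoxes (addable_of_mem_horizontalStrips (mem_sigma.1 h).1)]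

namespace VerticalPieri

variable {k : ℕ} {e : ℕ → R} {F : (Fin n → ℕ) → R} {m l : Fin n → ℕ}

theorem mul_stripSum (hF : VerticalPieri k e F) (hm : ∑ i, m i = k) (i j : ℕ) :
    e i * stripSum F j m = ∑ b ∈ piAntidiag univ (i + j) with Addable m b,
      ∑ v ∈ splits m b with ∑ t, v t = i, F (addBoxes m b) := by
  rw [← sum_horizontal_vertical, stripSum, mul_sum]
  exact sum_congr rfl fun a ha =>
    hF _ ((sum_addBoxes (addable_of_mem_horizontalStrips ha)).trans hm) i

theorem alternating_sum (hF : VerticalPieri k e F) (hm : ∑ i, m i = k) {r : ℕ} (hpos : 0 < r)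
    (hr : r < k + n) :
    ∑ i ∈ range (r + 1), (-1) ^ i * (e i * stripSum F (r - i) m) = 0 := calc
  _ = ∑ i ∈ range (r + 1), ∑ b ∈ piAntidiag univ r with Addable m b,
        ∑ v ∈ splits m b with ∑ t, v t = i, (-1) ^ (∑ t, v t) * F (addBoxes m b) := by
    refine sum_congr rfl fun i hi => ?_
    rw [hF.mul_stripSum hm, Nat.add_sub_cancel' (mem_range_succ_iff.1 hi), mul_sum]
    refine sum_congr rfl fun b _ => ?_
    rw [mul_sum]
    exact sum_congr rfl fun v hv => by rw [(mem_filter.1 hv).2]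
  _ = ∑ b ∈ piAntidiag univ r with Addable m b,
        ∑ v ∈ splits m b, (-1) ^ (∑ t, v t) * F (addBoxes m b) := by
    rw [sum_comm]
    refine sum_congr rfl fun b hb => sum_fiberwise_of_maps_to (fun v hv => ?_) _
    have sum_b : ∑ t, b t = r := (mem_piAntidiag.1 (mem_filter.1 hb).1).1
    exact mem_range_succ_iff.2 ((sum_le_of_mem_splits hv).trans sum_b.le)
  _ = 0 := by
    refine sum_eq_zero fun b hb => ?_
    obtain ⟨hb, addable⟩ := mem_filter.1 hb
    have sum_b : ∑ t, b t = r := (mem_piAntidiag.1 hb).1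
    rw [← sum_mul, sum_sign_splits R addable (by omega) (by omega), zero_mul]

/-- The quotient `stripSum F r m / F m`, which should be the complete symmetric polynomial of degree
`r`, satisfies a recursion that does not involve `m`. -/
theorem stripSum_mul (hF : VerticalPieri k e F) (he : e 0 = 1) (hm : ∑ i, m i = k)
    (hl : ∑ i, l i = k) (r : ℕ) (hr : r < k + n) :
    stripSum F r m * F l = stripSum F r l * F m := by
  induction r using Nat.strong_induction_on with
  | _ r ih =>
    rcases Nat.eq_zero_or_pos r with rfl | hpos
    · rw [stripSum_zero, stripSum_zero, mul_comm]
    have recursion {m : Fin n → ℕ} (hm : ∑ i, m i = k) : stripSum F r m =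
        -∑ i ∈ range r, (-1) ^ (i + 1) * (e (i + 1) * stripSum F (r - (i + 1)) m) := by
      have := hF.alternating_sum hm hpos hr
      rw [sum_range_succ'] at this
      linear_combination this - stripSum F r m * he
    rw [recursion hm, recursion hl, neg_mul, neg_mul, sum_mul, sum_mul]
    refine congrArg Neg.neg (sum_congr rfl fun i _ => ?_)
    have smaller := ih (r - (i + 1)) (by omega) (by omega)
    linear_combination (-1) ^ (i + 1) * e (i + 1) * smaller

end VerticalPieri

end Pieri

section Independence

variable {n k : ℕ} [NeZero n] {R ι : Type*} [CommRing R] [NoZeroDivisors R]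

/-- The multipliers act as commuting operators with the `F a` as common eigenvectors, and the
eigenvalues separate the indices `a`. -/
theorem VerticalPieri.linearIndependent {e : ι → ℕ → R} {F : ι → (Fin n → ℕ) → R}
    (hF : ∀ a, VerticalPieri k (e a) (F a)) (he : Function.Injective e)
    (hne : ∀ a, ∃ m : Weight n k, F a m.1 ≠ 0) :
    LinearIndependent R fun a (m : Weight n k) => F a m.1 := by
  classical
  rw [linearIndependent_iff']
  intro s
  induction s using Finset.induction_on with
  | empty => simp
  | insert a s ha ih =>
    intro c hc
    have relation (m : Weight n k) : ∑ x ∈ insert a s, c x * F x m.1 = 0 := by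
      simpa using congrFun hc m
    have eigen (r : ℕ) (m : Weight n k) :
        ∑ x ∈ s, (e x r - e a r) * c x * F x m.1 = 0 := calc
      _ = ∑ x ∈ insert a s, (e x r - e a r) * c x * F x m.1 := by simp [sum_insert ha]
      _ = ∑ x ∈ insert a s, c x * (e x r * F x m.1) - e a r * ∑ x ∈ insert a s, c x * F x m.1 := by
        rw [mul_sum, ← sum_sub_distrib]
        exact sum_congr rfl fun x _ => by ring
      _ = ∑ b ∈ verticalStrips m.1 r, ∑ x ∈ insert a s, c x * F x (addBoxes m.1 b) := by
        rw [relation, mul_zero, sub_zero, sum_comm]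
        exact sum_congr rfl fun x _ => by rw [hF x m.1 m.2 r, mul_sum]
      _ = 0 := sum_eq_zero fun b hb =>
        relation ⟨_, (sum_addBoxes (addable_of_mem_verticalStrips hb)).trans m.2⟩
    have zero_on_s : ∀ x ∈ s, c x = 0 := by
      intro x hx
      obtain ⟨r, hr⟩ := Function.ne_iff.1 (he.ne (ne_of_mem_of_not_mem hx ha))
      refine (mul_eq_zero.1 (ih (fun y => (e y r - e a r) * c y) ?_ x hx)).resolve_left
        (sub_ne_zero.2 hr)
      funext m
      simpa using eigen r m
    obtain ⟨m, hm⟩ := hne a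
    have := relation m
    rw [sum_insert ha, sum_eq_zero fun x hx => by rw [zero_on_s x hx, zero_mul], add_zero] at this
    exact forall_mem_insert _ _ _ |>.2 ⟨(mul_eq_zero.1 this).resolve_right hm, zero_on_s⟩

end Independence

theorem eq_of_esymm_eq {R : Type*} [CommRing R] [IsDomain R] {s t : Multiset R}
    (hcard : s.card = t.card) (h : s.esymm = t.esymm) : s = t := by
  rw [← Polynomial.roots_multiset_prod_X_sub_C s, Multiset.prod_X_sub_X_eq_sum_esymm, hcard, h,
    ← Multiset.prod_X_sub_X_eq_sum_esymm, Polynomial.roots_multiset_prod_X_sub_C]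

section Determinants

variable {ι R : Type*} [Fintype ι] [DecidableEq ι] [CommRing R]

theorem esymm_eq_sum_prod_pow (X : ι → R) (r : ℕ) :
    (univ.val.map X).esymm r = ∑ b ∈ piAntidiag univ r with ∀ i, b i ≤ 1, ∏ i, X i ^ b i := by
  rw [esymm_map_val]
  refine sum_bij' (fun t _ i => if i ∈ t then 1 else 0) (fun b _ => univ.filter (b · = 1))
    ?_ ?_ ?_ ?_ ?_
  · intro t ht
    have : ∀ i, (if i ∈ t then 1 else 0) ≤ 1 := fun i => by split_ifs <;> simp
    simpa [this] using ht
  · intro b hb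
    obtain ⟨hb, b_le⟩ := mem_filter.1 hb
    have : ∀ i, b i = if b i = 1 then 1 else 0 := fun i => by
      have := b_le i
      split_ifs <;> omega
    rw [mem_powersetCard_univ, card_filter, ← sum_congr rfl fun i _ => this i]
    exact (mem_piAntidiag.1 hb).1
  · intro t _
    simp
  · intro b hb
    funext i
    have := (mem_filter.1 hb).2 i
    simp only [mem_filter_univ]
    split_ifs <;> omega
  · intro t _
    simp [pow_ite, prod_ite_mem]

theorem esymm_mul_det (X : ι → R) (l : ι → ℕ) (r : ℕ) :
    (univ.val.map X).esymm r * (Matrix.of fun i j => X i ^ l j).det =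
      ∑ b ∈ piAntidiag univ r with ∀ i, b i ≤ 1, (Matrix.of fun i j => X i ^ (l j + b j)).det := by
  simp only [Matrix.det_apply', Matrix.of_apply, mul_sum]
  rw [sum_comm]
  refine sum_congr rfl fun w _ => ?_
  have permuted : (univ.val.map X).esymm r = (univ.val.map (X ∘ w)).esymm r := by
    rw [← Multiset.map_map, Multiset.map_univ_val_equiv]
  rw [permuted, esymm_eq_sum_prod_pow, sum_mul]
  refine sum_congr rfl fun b _ => ?_
  simp only [pow_add, prod_mul_distrib, Function.comp_apply]
  ring

theorem det_pow_add_const (X : ι → R) (l : ι → ℕ) (c : ℕ) :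
    (Matrix.of fun i j => X i ^ (l j + c)).det =
      (∏ i, X i) ^ c * (Matrix.of fun i j => X i ^ l j).det := by
  rw [← prod_pow, ← Matrix.det_mul_column]
  simp only [pow_add, mul_comm, Matrix.of_apply]

theorem det_eq_zero_of_col_eq_mul {M : Matrix ι ι R} {i j : ι} (hij : i ≠ j) (z : R)
    (h : ∀ a, M a i = z * M a j) : M.det = 0 := by
  have : M = M.updateCol i (z • fun a => M a j) := by
    ext a b
    obtain rfl | hb := eq_or_ne b i
    · simp [h]
    · simp [hb]
  rw [this, Matrix.det_updateCol_smul, Matrix.det_updateCol_eq_zero hij.symm, mul_zero]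

end Determinants

section Alternant

theorem part_eq_zero_of_le {n k : ℕ} (m : Weight n k) {i : ℕ} (hi : n ≤ i + 1) : part m i = 0 :=
  sum_eq_zero fun j hj => by
    have := (mem_filter.1 hj).2
    omega

variable {n : ℕ} [NeZero n] {R : Type*} [CommRing R]

theorem val_add_one_of_ne_nodeN {i : Fin n} (hi : i ≠ nodeN n) : (i + 1).val = i.val + 1 := by
  refine Fin.val_add_one_of_lt' ?_
  have := Fin.val_ne_iff.2 hi
  simp only [nodeN] at this
  omega

theorem part_nodeN {k : ℕ} (m : Weight n k) : part m (nodeN n) = 0 :=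
  part_eq_zero_of_le m le_tsub_add

theorem part_add_one {k : ℕ} (m : Weight n k) (i : Fin n) :
    part m (i + 1 : Fin n) + m.1 i = part m i + if i = nodeN n then k else 0 := by
  split_ifs with hi
  · have others : univ.filter (fun j : Fin n => 0 ≤ j.1 ∧ j.1 + 1 < n) = univ.erase i := by
      ext j
      simp only [hi, mem_filter_univ, mem_erase, mem_univ, and_true, Ne, Fin.ext_iff, nodeN]
      omega
    rw [hi, nodeN_add_one, part_nodeN, zero_add, ← hi, part, Fin.val_zero, others,
      sum_erase_add _ _ (mem_univ i), m.2]
  · have hval := val_add_one_of_ne_nodeN hi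
    have hlt := hval ▸ (i + 1).isLt
    have tail : univ.filter (fun j : Fin n => i.1 ≤ j.1 ∧ j.1 + 1 < n) =
        insert i (univ.filter fun j : Fin n => (i + 1).1 ≤ j.1 ∧ j.1 + 1 < n) := by
      ext j
      simp only [mem_filter_univ, mem_insert, Fin.ext_iff, hval]
      omega
    rw [part, part, tail, sum_insert (by simp [hval]), add_comm, add_zero]

/-- The part `λ_{i+1} + n - 1 - i` of the partition with Dynkin labels `m`, shifted by the
staircase. -/
def exponent (m : Fin n → ℕ) (i : Fin n) : ℕ := part (⟨m, rfl⟩ : Weight n _) i + (n - 1 - i)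

theorem exponent_nodeN (m : Fin n → ℕ) : exponent m (nodeN n) = 0 := by
  rw [exponent, part_nodeN]
  simp only [nodeN, Nat.sub_self, add_zero]

/-- Along the cycle of nodes the exponents are periodic up to the height `∑ i, m i + n`. -/
theorem exponent_add_one (m : Fin n → ℕ) (i : Fin n) :
    exponent m (i + 1) + m i + 1 =
      exponent m i + if i = nodeN n then ∑ j, m j + n else 0 := by
  have step := part_add_one ⟨m, rfl⟩ i
  rw [exponent, exponent]
  split_ifs at step ⊢ with hi
  · have := NeZero.pos n
    have : (nodeN n).val = n - 1 := rfl
    simp only [hi, nodeN_add_one, Fin.val_zero] at step ⊢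
    omega
  · have hval := val_add_one_of_ne_nodeN hi
    have := hval ▸ (i + 1).isLt
    rw [hval] at step ⊢
    dsimp only at step
    omega

theorem AddsBoxes.exponent_eq {m b l : Fin n → ℕ} (h : AddsBoxes m b l) (i : Fin n) :
    exponent l i + b (nodeN n) = exponent m i + b i := by
  refine cyclic_induction (p := fun i => exponent l i + b (nodeN n) = exponent m i + b i)
    (a := nodeN n) (by rw [exponent_nodeN, exponent_nodeN]) (fun i hi => ?_) i
  have := exponent_add_one m i
  have := exponent_add_one l i
  have := h i
  rw [h.sum_eq] at *
  omega

/-- The alternant of the points `X` at the shifted partition with Dynkin labels `m`. -/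
def alternant (X : Fin n → R) (m : Fin n → ℕ) : R := (Matrix.of fun i j => X i ^ exponent m j).det

theorem alternant_addBoxes {X : Fin n → R} (hX : ∏ i, X i = 1) {m b : Fin n → ℕ}
    (h : Addable m b) :
    alternant X (addBoxes m b) = (Matrix.of fun i j => X i ^ (exponent m j + b j)).det := by
  simp only [← (addsBoxes_addBoxes h).exponent_eq, det_pow_add_const, hX, one_pow, one_mul]
  rfl

theorem det_eq_zero_of_not_addable {X : Fin n → R} {m b : Fin n → ℕ} {z : R}
    (hz : ∀ i, X i ^ (∑ j, m j + n) = z) (hb : ∀ i, b i ≤ 1) (h : ¬ Addable m b) :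
    (Matrix.of fun i j => X i ^ (exponent m j + b j)).det = 0 := by
  obtain ⟨i, hi⟩ := not_forall.1 h
  have := hb (i + 1)
  obtain ⟨hm, hbi, hbi'⟩ : m i = 0 ∧ b i = 0 ∧ b (i + 1) = 1 := by omega
  refine det_eq_zero_of_col_eq_mul (i := i + 1) (j := i) (fun heq => ?_)
    (if i = nodeN n then z else 1) fun a => ?_
  · rw [heq] at hbi'
    omega
  · have periodic := exponent_add_one m i
    rw [hm, add_zero] at periodic
    simp only [Matrix.of_apply, hbi, hbi', periodic, add_zero]
    split_ifs
    · rw [pow_add, hz, mul_comm]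
    · rw [add_zero, one_mul]

theorem verticalPieri_alternant {X : Fin n → R} (hX : ∏ i, X i = 1) {k : ℕ} {z : R}
    (hz : ∀ i, X i ^ (k + n) = z) : VerticalPieri k (univ.val.map X).esymm (alternant X) := by
  rintro m rfl r
  rw [alternant, esymm_mul_det, verticalStrips, ← filter_filter, sum_filter (Addable m)]
  refine sum_congr (by congr) fun b hb => ?_
  split_ifs with h
  · exact (alternant_addBoxes hX h).symm
  · exact det_eq_zero_of_not_addable hz (mem_filter.1 hb).2 h

end Alternant

section Coordinates

variable {n k : ℕ}

/-- The coordinates of the sum of the finite part of a weight and the Weyl vector. -/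
noncomputable def shiftedCoord (sig : Weight n k) (i : Fin n) : ℝ :=
  finitePart sig i + weylVector n i

theorem shiftedCoord_sub (sig : Weight n k) (i j : Fin n) :
    shiftedCoord sig i - shiftedCoord sig j = exponent sig.1 i - exponent sig.1 j := by
  have cast_exponent (i : Fin n) : (exponent sig.1 i : ℝ) = part sig i + (n - 1 - i) := by
    rw [exponent, Nat.cast_add, Nat.cast_sub (Nat.le_sub_one_of_lt i.2), Nat.cast_pred i.pos]
    rfl
  simp only [shiftedCoord, finitePart, weylVector, cast_exponent]
  ring

theorem exponent_strictAnti (m : Fin n → ℕ) : StrictAnti (exponent m) := by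
  intro i j hij
  have := part_anti (⟨m, rfl⟩ : Weight n _) (Fin.le_def.1 hij.le)
  have := Fin.lt_def.1 hij
  simp only [exponent]
  omega

theorem shiftedCoord_strictAnti (sig : Weight n k) : StrictAnti (shiftedCoord sig) := by
  intro i j hij
  have := shiftedCoord_sub sig i j
  have : (exponent sig.1 j : ℝ) < exponent sig.1 i := mod_cast exponent_strictAnti sig.1 hij
  linarith

theorem sum_weylVector (n : ℕ) : ∑ i, weylVector n i = 0 := by
  have antisymm : ∑ i, weylVector n i = -∑ i, weylVector n i := by
    rw [← sum_neg_distrib, ← Equiv.sum_comp Fin.revPerm]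
    refine sum_congr rfl fun i _ => ?_
    rw [weylVector, weylVector, Fin.revPerm_apply, Fin.val_rev, Nat.cast_sub i.2]
    push_cast
    ring
  linarith

variable [NeZero n]

theorem sum_finitePart (sig : Weight n k) : ∑ i, finitePart sig i = 0 := by
  have : (n : ℝ) ≠ 0 := NeZero.ne _
  simp only [finitePart, sum_sub_distrib, sum_const, card_univ, Fintype.card_fin, nsmul_eq_mul]
  rw [mul_div_cancel₀ _ this, sub_self]

theorem sum_shiftedCoord (sig : Weight n k) : ∑ i, shiftedCoord sig i = 0 := by
  simp only [shiftedCoord, sum_add_distrib, sum_finitePart, sum_weylVector, add_zero]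

theorem shiftedCoord_sub_lt (sig : Weight n k) (i j : Fin n) :
    shiftedCoord sig i - shiftedCoord sig j < k + n := by
  have le_first : exponent sig.1 i ≤ exponent sig.1 0 :=
    (exponent_strictAnti sig.1).antitone (Fin.zero_le i)
  have wrap := exponent_add_one sig.1 (nodeN n)
  rw [exponent_nodeN, nodeN_add_one, if_pos rfl, sig.2] at wrap
  have : (exponent sig.1 i : ℝ) < exponent sig.1 j + (k + n) := by
    norm_cast
    omega
  rw [shiftedCoord_sub]
  linarith

theorem exponent_inj {m l : Fin n → ℕ} (hsum : ∑ i, m i = ∑ i, l i) :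
    exponent m = exponent l ↔ m = l := by
  refine ⟨fun h => funext fun i => ?_, congrArg _⟩
  have hm := exponent_add_one m i
  have hl := exponent_add_one l i
  rw [h, hsum] at hm
  omega

theorem shiftedCoord_injective : Function.Injective (shiftedCoord : Weight n k → Fin n → ℝ) := by
  intro sig tau h
  refine Subtype.ext ((exponent_inj (sig.2.trans tau.2.symm)).1 (funext fun i => ?_))
  have := shiftedCoord_sub sig i (nodeN n)
  rw [h, shiftedCoord_sub, exponent_nodeN, exponent_nodeN] at this
  simpa using this.symm

theorem height_pos (n k : ℕ) [NeZero n] : 0 < (k : ℝ) + n :=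
  add_pos_of_nonneg_of_pos k.cast_nonneg (Nat.cast_pos.2 (NeZero.pos n))

theorem eq_zero_of_sum_eq_zero_of_le_add_one {ι : Type*} [Fintype ι] {t : ι → ℤ}
    (hsum : ∑ i, t i = 0) (h : ∀ i j, t i ≤ t j + 1) : t = 0 := by
  have nonpos : ∀ i, t i ≤ 0 := by
    by_contra! hpos
    obtain ⟨i, hi⟩ := hpos
    have nonneg : ∀ j, 0 ≤ t j := fun j => by
      have := h i j
      omega
    have := (sum_eq_zero_iff_of_nonneg fun j _ => nonneg j).1 hsum i (mem_univ i)
    omega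
  exact funext fun i => (sum_eq_zero_iff_of_nonpos fun j _ => nonpos j).1 hsum i (mem_univ i)

/-- Up to permutations, the shifted weights of level `k` are pairwise incongruent modulo `k + n`. -/
theorem eq_of_shiftedCoord_congr {sig tau : Weight n k} (w : Equiv.Perm (Fin n)) (t : Fin n → ℤ)
    (h : ∀ i, shiftedCoord sig (w i) = shiftedCoord tau i + (k + n) * t i) : sig = tau := by
  have pos := height_pos n k
  have sum_t : ∑ i, t i = 0 := by
    have := Fintype.sum_congr _ _ h
    rw [Equiv.sum_comp w, sum_add_distrib, sum_shiftedCoord, sum_shiftedCoord, zero_add,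
      ← mul_sum] at this
    exact_mod_cast (mul_eq_zero.1 this.symm).resolve_left pos.ne'
  have close (i j : Fin n) : t i ≤ t j + 1 := by
    have hsig := shiftedCoord_sub_lt sig (w i) (w j)
    have htau := shiftedCoord_sub_lt tau j i
    rw [h, h] at hsig
    have : (t i : ℝ) < t j + 2 := lt_of_mul_lt_mul_left (by linarith) pos.le
    have : t i < t j + 2 := mod_cast this
    omega
  have comp : shiftedCoord sig ∘ w = shiftedCoord tau := by
    funext i
    simp [h, eq_zero_of_sum_eq_zero_of_le_add_one sum_t close]
  refine shiftedCoord_injective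
    (((shiftedCoord_strictAnti sig).range_inj (shiftedCoord_strictAnti tau)).1 ?_)
  rw [← comp, w.surjective.range_comp]

end Coordinates

section ModularMatrix

variable {n k : ℕ}

/-- The values of the formal exponentials `e^{ε_i}` at `-2πi (σ + ρ) / (k + n)`, on which the column
of `σ` in the modular matrix depends. -/
noncomputable def points (sig : Weight n k) (i : Fin n) : ℂ :=
  Complex.exp (-(2 * Real.pi * Complex.I / (k + n)) * shiftedCoord sig i)

/-- The scalar in front of the alternating sum in the modular matrix. -/
noncomputable def prefactor (n k : ℕ) : ℂ :=
  Complex.exp (Complex.I * Real.pi * n * (n - 1) / 4) /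
    (Real.sqrt ((n : ℝ) * ((k : ℝ) + n) ^ (n - 1)) : ℝ)

theorem modularS_symm (lam sig : Weight n k) : modularS n k lam sig = modularS n k sig lam := by
  simp only [modularS, Matrix.of_apply]
  rw [← Equiv.sum_comp (Equiv.inv (Equiv.Perm (Fin n)))]
  refine congrArg _ (sum_congr rfl fun w _ => ?_)
  rw [Equiv.inv_apply, Equiv.Perm.sign_inv, inv_inv, ← Equiv.sum_comp w⁻¹]
  simp only [← Equiv.Perm.mul_apply, mul_inv_cancel, Equiv.Perm.one_apply, mul_comm]

variable [NeZero n]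

theorem height_ne_zero (n k : ℕ) [NeZero n] : (k : ℂ) + n ≠ 0 :=
  mod_cast (height_pos n k).ne'

theorem prefactor_ne_zero : prefactor n k ≠ 0 := by
  have : 0 < (n : ℝ) * ((k : ℝ) + n) ^ (n - 1) :=
    mul_pos (Nat.cast_pos.2 (NeZero.pos n)) (pow_pos (height_pos n k) _)
  exact div_ne_zero (Complex.exp_ne_zero _) (Complex.ofReal_ne_zero.2 (Real.sqrt_pos.2 this).ne')

theorem modularS_eq (lam sig : Weight n k) :
    modularS n k lam sig = prefactor n k * alternant (points sig) lam.1 := by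
  rw [modularS, Matrix.of_apply, alternant, Matrix.det_apply', prefactor]
  refine congrArg _ (sum_congr rfl fun w _ => congrArg _ ?_)
  have pairing : ∑ i, shiftedCoord sig i * shiftedCoord lam (w⁻¹ i) =
      ∑ i, shiftedCoord sig (w i) * exponent lam.1 i := calc
    _ = ∑ i, shiftedCoord sig i *
          (exponent lam.1 (w⁻¹ i) + shiftedCoord lam (nodeN n)) := by
      refine sum_congr rfl fun i _ => ?_
      have := shiftedCoord_sub lam (w⁻¹ i) (nodeN n)
      rw [exponent_nodeN, Nat.cast_zero, sub_zero] at this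
      rw [← this, sub_add_cancel]
    _ = ∑ i, shiftedCoord sig i * exponent lam.1 (w⁻¹ i) := by
      simp only [mul_add, sum_add_distrib, ← sum_mul, sum_shiftedCoord, zero_mul, add_zero]
    _ = _ := by
      rw [← Equiv.sum_comp w]
      simp only [← Equiv.Perm.mul_apply, inv_mul_cancel, Equiv.Perm.one_apply]
  change Complex.exp (_ * (∑ i, shiftedCoord sig i * shiftedCoord lam (w⁻¹ i) : ℝ)) = _
  rw [pairing, Complex.ofReal_sum, mul_sum, Complex.exp_sum]
  refine prod_congr rfl fun i _ => ?_
  rw [Matrix.of_apply, points, ← Complex.exp_nat_mul]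
  push_cast
  ring_nf

theorem prod_points (sig : Weight n k) : ∏ i, points sig i = 1 := by
  simp only [points]
  rw [← Complex.exp_sum, ← mul_sum, ← Complex.ofReal_sum, sum_shiftedCoord, Complex.ofReal_zero,
    mul_zero, Complex.exp_zero]

theorem exists_int_of_points_eq {sig tau : Weight n k} {i j : Fin n}
    (h : points sig i = points tau j) :
    ∃ t : ℤ, shiftedCoord sig i = shiftedCoord tau j + (k + n) * t := by
  obtain ⟨t, ht⟩ := Complex.exp_eq_exp_iff_exists_int.1 h
  refine ⟨-t, Complex.ofReal_injective (mul_left_cancel₀ Complex.two_pi_I_ne_zero ?_)⟩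
  have := height_ne_zero n k
  field_simp at ht
  push_cast
  linear_combination (-(2 * Real.pi * Complex.I)) * ht

theorem points_pow (sig : Weight n k) (i : Fin n) :
    points sig i ^ (k + n) = points sig (nodeN n) ^ (k + n) := by
  rw [points, points, ← Complex.exp_nat_mul, ← Complex.exp_nat_mul,
    Complex.exp_eq_exp_iff_exists_int]
  refine ⟨-exponent sig.1 i, ?_⟩
  have diff := congrArg ((↑) : ℝ → ℂ) (shiftedCoord_sub sig i (nodeN n))
  rw [exponent_nodeN] at diff
  push_cast at diff ⊢
  have := height_ne_zero n k
  field_simp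
  linear_combination -diff

theorem points_injective (sig : Weight n k) : Function.Injective (points sig) := by
  intro i j h
  obtain ⟨t, ht⟩ := exists_int_of_points_eq h
  have pos := height_pos n k
  have hij := shiftedCoord_sub_lt sig i j
  have hji := shiftedCoord_sub_lt sig j i
  have : (t : ℝ) < 1 := lt_of_mul_lt_mul_left (by linarith) pos.le
  have : (-1 : ℝ) < t := lt_of_mul_lt_mul_left (by linarith) pos.le
  have : t < 1 := by assumption_mod_cast
  have : -1 < t := by assumption_mod_cast
  obtain rfl : t = 0 := by omega
  exact (shiftedCoord_strictAnti sig).injective (by simpa using ht)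

theorem esymm_points_injective :
    Function.Injective fun sig : Weight n k => (univ.val.map (points sig)).esymm := by
  intro sig tau h
  have same_points := eq_of_esymm_eq (by simp only [Multiset.card_map]) h
  have (i : Fin n) : ∃ j, points sig j = points tau i := by
    have : points tau i ∈ univ.val.map (points sig) :=
      same_points ▸ Multiset.mem_map_of_mem _ (mem_univ_val i)
    simpa using this
  choose w hw using this
  have w_injective : Function.Injective w := fun i j hij =>
    points_injective tau (by rw [← hw i, ← hw j, hij])
  choose t ht using fun i => exists_int_of_points_eq (hw i)
  exact eq_of_shiftedCoord_congr
    (Equiv.ofBijective w (Finite.injective_iff_bijective.1 w_injective)) t ht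

theorem verticalPieri_points (sig : Weight n k) :
    VerticalPieri k (univ.val.map (points sig)).esymm (alternant (points sig)) :=
  verticalPieri_alternant (prod_points sig) (points_pow sig)

end ModularMatrix

section SpecialWeights

variable {n k : ℕ}

theorem rowLen_rect (a b i : ℕ) : (rect a b).rowLen i = if i < a then b else 0 :=
  eq_of_forall_lt_iff fun j => by
    rw [← YoungDiagram.mem_iff_lt_rowLen, mem_rect]
    split_ifs with h <;> simp [h]

theorem colLen_zero_le_iff {lam : YoungDiagram} : lam.colLen 0 ≤ n ↔ lam.rowLen n = 0 := by
  rw [← not_lt, ← YoungDiagram.mem_iff_lt_colLen, YoungDiagram.mem_iff_lt_rowLen,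
    Nat.pos_iff_ne_zero, not_not]

variable [NeZero n]

theorem ne_nodeN_iff {i : Fin n} : i ≠ nodeN n ↔ i.1 + 1 < n := by
  have := i.2
  simp only [Ne, Fin.ext_iff, nodeN]
  omega

theorem antitone_of_add_one_le {α : Type*} [Preorder α] {f : Fin n → α}
    (h : ∀ i ≠ nodeN n, f (i + 1) ≤ f i) : Antitone f := by
  obtain ⟨N, rfl⟩ := Nat.exists_eq_succ_of_ne_zero (NeZero.ne n)
  refine Fin.antitone_iff_succ_le.2 fun i => ?_
  rw [← Fin.coeSucc_eq_succ]
  exact h _ (ne_nodeN_iff.2 (Nat.succ_lt_succ i.2))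

theorem emptyWeight_apply (i : Fin n) :
    (emptyWeight n k).1 i = if i = nodeN n then k else 0 := by
  simp only [emptyWeight, hat, ← ne_nodeN_iff, rowLen_rect, Nat.not_lt_zero, if_false, ite_not,
    Nat.sub_zero]

theorem addsBoxes_hat {lam : YoungDiagram} (hn : lam.colLen 0 < n) (hk : lam.rowLen 0 ≤ k) :
    AddsBoxes (emptyWeight n k).1 (fun i => lam.rowLen i) (hat lam hn hk).1 := by
  intro i
  rw [emptyWeight_apply]
  obtain rfl | hi := eq_or_ne i (nodeN n)
  · have : lam.rowLen (nodeN n) = 0 := colLen_zero_le_iff.1 (Nat.le_sub_one_of_lt hn)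
    simp only [hat, if_neg (ne_nodeN_iff.not_right.1 rfl), if_pos, nodeN_add_one, Fin.val_zero,
      this]
    omega
  · have := lam.rowLen_anti i (i + 1) i.1.le_succ
    simp only [hat, if_pos (ne_nodeN_iff.1 hi), if_neg hi, val_add_one_of_ne_nodeN hi]
    omega

theorem addsBoxes_columnWeight {r : ℕ} (hr : r < n) (hk : r = 0 ∨ 0 < k) :
    AddsBoxes (emptyWeight n k).1 (fun i => (rect r 1).rowLen i) (columnWeight n k r hr hk).1 :=
  addsBoxes_hat _ _

theorem addsBoxes_rowWeight (hn : 2 ≤ n) {r : ℕ} (hr : r ≤ k) :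
    AddsBoxes (emptyWeight n k).1 (fun i => (rect 1 r).rowLen i) (rowWeight n k r hn hr).1 :=
  addsBoxes_hat _ _

theorem eq_of_antitone_of_sum_eq {ι : Type*} [Fintype ι] [LinearOrder ι] {b c : ι → ℕ}
    (hb : Antitone b) (hc : Antitone c) (hb1 : ∀ i, b i ≤ 1) (hc1 : ∀ i, c i ≤ 1)
    (hsum : ∑ i, b i = ∑ i, c i) : b = c := by
  suffices le : ∀ i, b i ≤ c i from
    funext fun i => (sum_eq_sum_iff_of_le fun i _ => le i).1 hsum i (mem_univ i)
  by_contra! ⟨i, hi⟩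
  refine hsum.not_gt (sum_lt_sum (fun j _ => ?_) ⟨i, mem_univ i, hi⟩)
  have := hb1 i
  have := hc1 j
  obtain hij | hij := le_total i j
  · have := hc hij
    omega
  · have := hb hij
    omega

theorem antitone_of_addable_emptyWeight {b : Fin n → ℕ} (h : Addable (emptyWeight n k).1 b) :
    Antitone b :=
  antitone_of_add_one_le fun i hi => by simpa [emptyWeight_apply, hi] using h i

theorem verticalStrips_emptyWeight {r : ℕ} (hr : r < n) (hk : r = 0 ∨ 0 < k) :
    verticalStrips (emptyWeight n k).1 r = {fun i : Fin n => (rect r 1).rowLen i} := by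
  have column : (fun i : Fin n => (rect r 1).rowLen i) ∈ verticalStrips (emptyWeight n k).1 r := by
    refine mem_verticalStrips.2 ⟨?_, fun i => ?_, (addsBoxes_columnWeight hr hk).addable⟩
    · simp [rowLen_rect, Fin.card_filter_val_lt, hr.le]
    · rw [rowLen_rect]
      split_ifs <;> simp
  refine eq_singleton_iff_unique_mem.2 ⟨column, fun b hb => ?_⟩
  obtain ⟨sum_b, b_le, hb⟩ := mem_verticalStrips.1 hb
  obtain ⟨sum_c, c_le, hc⟩ := mem_verticalStrips.1 column
  exact eq_of_antitone_of_sum_eq (antitone_of_addable_emptyWeight hb)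
    (antitone_of_addable_emptyWeight hc) b_le c_le (sum_b.trans sum_c.symm)

theorem horizontalStrips_emptyWeight {r : ℕ} (hr : r ≤ k) :
    horizontalStrips (emptyWeight n k).1 r = {fun i : Fin n => (rect 1 r).rowLen i} := by
  have row : (fun i : Fin n => (rect 1 r).rowLen i) = Pi.single 0 r := by
    funext i
    simp only [rowLen_rect, Nat.lt_one_iff, Fin.val_eq_zero_iff, Pi.single_apply]
  rw [row]
  refine eq_singleton_iff_unique_mem.2 ⟨mem_horizontalStrips.2 ⟨by simp, fun i => ?_⟩, ?_⟩
  · rw [emptyWeight_apply, Pi.single_apply]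
    simp only [add_one_eq_zero_iff]
    split_ifs <;> omega
  · intro b hb
    obtain ⟨sum_b, hb⟩ := mem_horizontalStrips.1 hb
    have support : ∀ i ≠ 0, b i = 0 := fun i hi => by
      have := hb (i - 1)
      rw [emptyWeight_apply, sub_add_cancel, if_neg] at this
      · exact Nat.le_zero.1 this
      · rwa [← add_one_eq_zero_iff, sub_add_cancel]
    have b_zero : b 0 = r := by rw [← sum_b, Fintype.sum_eq_single 0 support]
    funext i
    obtain rfl | hi := eq_or_ne i 0
    · rw [b_zero, Pi.single_eq_same]
    · rw [support i hi, Pi.single_eq_of_ne hi]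

theorem alternant_emptyWeight_ne_zero (sig : Weight n k) :
    alternant (points sig) (emptyWeight n k).1 ≠ 0 := by
  have staircase (j : Fin n) : exponent (emptyWeight n k).1 j = j.rev := by
    rw [exponent, part, sum_eq_zero fun i hi => ?_, Fin.val_rev]
    · omega
    · exact (emptyWeight_apply i).trans (if_neg (ne_nodeN_iff.2 (mem_filter.1 hi).2.2))
  have vandermonde : (Matrix.of fun i j => points sig i ^ exponent (emptyWeight n k).1 j) =
      (Matrix.vandermonde (points sig)).submatrix id Fin.revPerm := by
    ext i j
    rw [Matrix.of_apply, staircase]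
    rfl
  rw [alternant, vandermonde, Matrix.det_permute']
  exact mul_ne_zero (Int.cast_ne_zero.2 (Units.ne_zero _))
    (Matrix.det_vandermonde_ne_zero_iff.2 (points_injective sig))

end SpecialWeights

section Fusion

variable {n k : ℕ} [NeZero n]

theorem isUnit_modularS : IsUnit (modularS n k) := by
  have rows : (modularS n k).row =
      (fun _ : Weight n k => Units.mk0 (prefactor n k) prefactor_ne_zero) •
        fun (sig m : Weight n k) => alternant (points sig) m.1 := by
    ext sig m
    exact (modularS_symm sig m).trans (modularS_eq m sig)
  rw [← Matrix.linearIndependent_rows_iff_isUnit, rows]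
  exact (VerticalPieri.linearIndependent verticalPieri_points esymm_points_injective
    fun sig => ⟨emptyWeight n k, alternant_emptyWeight_ne_zero sig⟩).units_smul _

open scoped Matrix in
theorem fusionCoeff_eq_of_expansion {lam mu : Weight n k} (c : Weight n k → ℂ)
    (h : ∀ sig, modularS n k lam sig * modularS n k mu sig =
      modularS n k (emptyWeight n k) sig * (c ᵥ* modularS n k) sig) (nu : Weight n k) :
    fusionCoeff lam mu nu = c nu := by
  have symm : (modularS n k).IsSymm := Matrix.IsSymm.ext fun _ _ => modularS_symm _ _
  have empty_ne_zero (sig : Weight n k) : modularS n k (emptyWeight n k) sig ≠ 0 := by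
    rw [modularS_eq]
    exact mul_ne_zero prefactor_ne_zero (alternant_emptyWeight_ne_zero sig)
  calc fusionCoeff lam mu nu
      = ∑ sig, (c ᵥ* modularS n k) sig * (modularS n k)⁻¹ sig nu := by
        refine sum_congr rfl fun sig _ => ?_
        rw [h, symm.inv.apply, mul_assoc, mul_div_cancel_left₀ _ (empty_ne_zero sig)]
    _ = (c ᵥ* (modularS n k * (modularS n k)⁻¹)) nu := by
        rw [← Matrix.vecMul_vecMul]
        rfl
    _ = c nu := by
        rw [Matrix.mul_nonsing_inv _ ((Matrix.isUnit_iff_isUnit_det _).1 isUnit_modularS),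
          Matrix.vecMul_one]

open scoped Classical Matrix in
theorem fusionCoeff_eq_ite {lam mu : Weight n k} {B : Finset (Fin n → ℕ)} {r : ℕ}
    (hB : ∀ b ∈ B, ∑ i, b i = r ∧ Addable mu.1 b)
    (h : ∀ sig : Weight n k, alternant (points sig) lam.1 * alternant (points sig) mu.1 =
      alternant (points sig) (emptyWeight n k).1 *
        ∑ b ∈ B, alternant (points sig) (addBoxes mu.1 b)) (nu : Weight n k) :
    fusionCoeff lam mu nu = if ∃ b ∈ B, AddsBoxes mu.1 b nu.1 then 1 else 0 := by
  have sum_indicator (b : Fin n → ℕ) (hb : b ∈ B) (sig : Weight n k) :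
      ∑ l : Weight n k, (if AddsBoxes mu.1 b l.1 then 1 else 0) * modularS n k l sig =
        prefactor n k * alternant (points sig) (addBoxes mu.1 b) := by
    have addable := (hB b hb).2
    rw [Fintype.sum_eq_single ⟨_, (sum_addBoxes addable).trans mu.2⟩ fun l hl => ?_,
      if_pos (addsBoxes_addBoxes addable), one_mul, modularS_eq]
    rw [if_neg fun hbl => hl (Subtype.ext ((addBoxes_eq_iff addable).2 hbl).symm), zero_mul]
  rw [fusionCoeff_eq_of_expansion
    (fun l => ∑ b ∈ B, if AddsBoxes mu.1 b l.1 then 1 else 0) fun sig => ?_]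
  · split_ifs with hex
    · obtain ⟨b, hb, hbl⟩ := hex
      rw [sum_eq_single_of_mem b hb fun a ha hne => if_neg fun hal =>
        hne (hal.boxes_unique hbl ((hB a ha).1.trans (hB b hb).1.symm)), if_pos hbl]
    · exact sum_eq_zero fun b hb => if_neg fun hbl => hex ⟨b, hb, hbl⟩
  · have expand : ((fun l : Weight n k => ∑ b ∈ B, if AddsBoxes mu.1 b l.1 then (1 : ℂ) else 0) ᵥ*
        modularS n k) sig =
        prefactor n k * ∑ b ∈ B, alternant (points sig) (addBoxes mu.1 b) := by
      simp only [Matrix.vecMul, dotProduct, sum_mul, mul_sum]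
      rw [sum_comm]
      exact sum_congr rfl fun b hb => sum_indicator b hb sig
    rw [expand, modularS_eq, modularS_eq, modularS_eq]
    linear_combination prefactor n k ^ 2 * h sig

open scoped Classical in
theorem fusionCoeff_columnWeight {r : ℕ} (hr : r < n) (hk : r = 0 ∨ 0 < k) (mu nu : Weight n k) :
    fusionCoeff (columnWeight n k r hr hk) mu nu =
      if ∃ b ∈ verticalStrips mu.1 r, AddsBoxes mu.1 b nu.1 then 1 else 0 := by
  refine fusionCoeff_eq_ite (fun b hb => ⟨(mem_verticalStrips.1 hb).1,
    addable_of_mem_verticalStrips hb⟩) (fun sig => ?_) nu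
  have column := addsBoxes_columnWeight hr hk
  have pieri_empty := verticalPieri_points sig _ (emptyWeight n k).2 r
  rw [verticalStrips_emptyWeight hr hk, sum_singleton,
    (addBoxes_eq_iff column.addable).2 column] at pieri_empty
  rw [← verticalPieri_points sig _ mu.2 r, ← pieri_empty]
  ring

open scoped Classical in
theorem fusionCoeff_rowWeight (hn : 2 ≤ n) {r : ℕ} (hr : r ≤ k) (mu nu : Weight n k) :
    fusionCoeff (rowWeight n k r hn hr) mu nu =
      if ∃ b ∈ horizontalStrips mu.1 r, AddsBoxes mu.1 b nu.1 then 1 else 0 := by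
  refine fusionCoeff_eq_ite (fun b hb => ⟨(mem_horizontalStrips.1 hb).1,
    addable_of_mem_horizontalStrips hb⟩) (fun sig => ?_) nu
  have row := addsBoxes_rowWeight hn hr
  have ratio := (verticalPieri_points sig).stripSum_mul (by simp [Multiset.esymm])
    (emptyWeight n k).2 mu.2 r (by omega)
  rw [stripSum, horizontalStrips_emptyWeight hr, sum_singleton,
    (addBoxes_eq_iff row.addable).2 row, mul_comm (stripSum _ _ _)] at ratio
  exact ratio

end Fusion

section YoungDiagrams

variable {n r : ℕ} {lam mu : YoungDiagram}

theorem eq_iff_rowLen : lam = mu ↔ ∀ i, lam.rowLen i = mu.rowLen i := by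
  refine ⟨fun h i => h ▸ rfl, fun h => ?_⟩
  ext ⟨i, j⟩
  simp only [YoungDiagram.mem_cells, YoungDiagram.mem_iff_lt_rowLen, h]

theorem le_iff_rowLen : mu ≤ lam ↔ ∀ i, mu.rowLen i ≤ lam.rowLen i := by
  refine ⟨fun h i => le_of_forall_lt fun j hj => ?_, fun h ⟨i, j⟩ hij => ?_⟩
  · exact YoungDiagram.mem_iff_lt_rowLen.1 (h (YoungDiagram.mem_iff_lt_rowLen.2 hj))
  · exact YoungDiagram.mem_iff_lt_rowLen.2 ((YoungDiagram.mem_iff_lt_rowLen.1 hij).trans_le (h i))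

theorem rowLen_deleteColumns (i : ℕ) :
    (deleteColumns n lam).rowLen i = lam.rowLen i - lam.rowLen (n - 1) :=
  eq_of_forall_lt_iff fun j => by
    rw [← YoungDiagram.mem_iff_lt_rowLen, ← YoungDiagram.mem_cells]
    simp only [deleteColumns, mem_filter, YoungDiagram.mem_cells, YoungDiagram.mem_iff_lt_rowLen]
    omega

theorem rowLen_eq_zero_of_le (h : lam.rowLen n = 0) {i : ℕ} (hi : n ≤ i) : lam.rowLen i = 0 :=
  Nat.eq_zero_of_le_zero ((lam.rowLen_anti n i hi).trans h.le)

theorem card_cells_eq_sum_rowLen (h : lam.rowLen n = 0) :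
    #lam.cells = ∑ i : Fin n, lam.rowLen i := by
  have maps : Set.MapsTo Prod.fst (lam.cells : Set (ℕ × ℕ)) (range n) := by
    rintro ⟨i, j⟩ hij
    have := YoungDiagram.mem_iff_lt_rowLen.1 ((YoungDiagram.mem_cells _).1 hij)
    refine mem_coe.2 (mem_range.2 (not_le.1 fun hi => ?_))
    rw [rowLen_eq_zero_of_le h hi] at this
    exact Nat.not_lt_zero j this
  rw [Fin.sum_univ_eq_sum_range lam.rowLen n, card_eq_sum_card_fiberwise maps]
  exact sum_congr rfl fun i _ => lam.rowLen_eq_card.symm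

theorem mem_cells_sdiff {i j : ℕ} :
    (i, j) ∈ lam.cells \ mu.cells ↔ mu.rowLen i ≤ j ∧ j < lam.rowLen i := by
  rw [mem_sdiff, YoungDiagram.mem_cells, YoungDiagram.mem_cells, YoungDiagram.mem_iff_lt_rowLen,
    YoungDiagram.mem_iff_lt_rowLen, not_lt, and_comm]

theorem isVerticalStrip_iff : IsVerticalStrip r lam mu ↔
    mu ≤ lam ∧ #(lam.cells \ mu.cells) = r ∧ ∀ i, lam.rowLen i ≤ mu.rowLen i + 1 := by
  refine and_congr_right fun _ => and_congr_right fun _ => ⟨fun h i => ?_, ?_⟩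
  · by_contra hlt
    have := h (i, mu.rowLen i) (mem_cells_sdiff.2 (by omega)) (i, mu.rowLen i + 1)
      (mem_cells_sdiff.2 (by omega)) rfl
    simp at this
  · rintro h ⟨i, j⟩ hc ⟨i', j'⟩ hd (rfl : i = i')
    have := h i
    have := mem_cells_sdiff.1 hc
    have := mem_cells_sdiff.1 hd
    exact Prod.ext rfl (by omega)

theorem isHorizontalStrip_iff : IsHorizontalStrip r lam mu ↔
    mu ≤ lam ∧ #(lam.cells \ mu.cells) = r ∧ ∀ i, lam.rowLen (i + 1) ≤ mu.rowLen i := by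
  refine and_congr_right fun _ => and_congr_right fun _ => ⟨fun h i => ?_, ?_⟩
  · by_contra hlt
    have := mu.rowLen_anti i (i + 1) i.le_succ
    have := lam.rowLen_anti i (i + 1) i.le_succ
    have := h (i, mu.rowLen i) (mem_cells_sdiff.2 (by omega)) (i + 1, mu.rowLen i)
      (mem_cells_sdiff.2 (by omega)) rfl
    simp at this
  · intro h
    have not_below : ∀ i i' j, (i, j) ∈ lam.cells \ mu.cells → (i', j) ∈ lam.cells \ mu.cells →
        i ≤ i' := by
      intro i i' j hc hd
      by_contra! hlt
      have := lam.rowLen_anti (i' + 1) i hlt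
      have := h i'
      have := mem_cells_sdiff.1 hc
      have := mem_cells_sdiff.1 hd
      omega
    rintro ⟨i, j⟩ hc ⟨i', j'⟩ hd (rfl : j = j')
    exact Prod.ext (le_antisymm (not_below _ _ _ hc hd) (not_below _ _ _ hd hc)) rfl

end YoungDiagrams

section Extensions

variable {n k : ℕ}

/-- The diagram `lam` arises from the diagram of the weight `m` by adding `b i` boxes to the row
`i`, for each of its `n` rows. -/
def ExtendsBy (lam : YoungDiagram) (m : Weight n k) (b : Fin n → ℕ) : Prop :=
  lam.rowLen n = 0 ∧ ∀ i : Fin n, lam.rowLen i = part m i + b i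

variable {lam : YoungDiagram} {m nu : Weight n k} {b : Fin n → ℕ} {r : ℕ}

theorem exists_extendsBy_of_le (hlam : lam.colLen 0 ≤ n) (hle : diagram m ≤ lam) :
    ∃ b, ExtendsBy lam m b := by
  refine ⟨fun i => lam.rowLen i - part m i, colLen_zero_le_iff.1 hlam, fun i => ?_⟩
  exact (Nat.add_sub_cancel' (rowLen_diagram m i ▸ le_iff_rowLen.1 hle i)).symm

namespace ExtendsBy

theorem diagram_le (h : ExtendsBy lam m b) : diagram m ≤ lam := by
  refine le_iff_rowLen.2 fun i => ?_
  rw [rowLen_diagram]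
  rcases lt_or_ge i n with hi | hi
  · exact (Nat.le_add_right _ _).trans (h.2 ⟨i, hi⟩).ge
  · simp only [part_eq_zero_of_le m (Nat.le_succ_of_le hi), Nat.zero_le]

theorem card_sdiff (h : ExtendsBy lam m b) : #(lam.cells \ (diagram m).cells) = ∑ i, b i := by
  have last : (diagram m).rowLen n = 0 :=
    Nat.eq_zero_of_le_zero ((le_iff_rowLen.1 h.diagram_le n).trans h.1.le)
  rw [card_sdiff_of_subset h.diagram_le, card_cells_eq_sum_rowLen h.1,
    card_cells_eq_sum_rowLen last]
  simp only [h.2, rowLen_diagram, sum_add_distrib, Nat.add_sub_cancel_left]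

theorem isVerticalStrip_iff (h : ExtendsBy lam m b) :
    IsVerticalStrip r lam (diagram m) ↔ ∑ i, b i = r ∧ ∀ i, b i ≤ 1 := by
  rw [SuFusion.isVerticalStrip_iff, h.card_sdiff, and_iff_right h.diagram_le]
  simp only [rowLen_diagram]
  refine and_congr_right fun _ => ⟨fun hb i => ?_, fun hb i => ?_⟩
  · simpa [h.2] using hb i
  · rcases lt_or_ge i n with hi | hi
    · exact (h.2 ⟨i, hi⟩).trans_le (Nat.add_le_add_left (hb _) _)
    · simp only [rowLen_eq_zero_of_le h.1 hi, Nat.zero_le]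

end ExtendsBy

variable [NeZero n]

theorem exists_extendsBy (h : Addable m.1 b) : ∃ lam, ExtendsBy lam m b := by
  have anti : Antitone fun i : Fin n => part m i + b i := antitone_of_add_one_le fun i hi => by
    have := part_add_one m i
    have := h i
    rw [if_neg hi] at *
    omega
  refine ⟨.ofRowLens (List.ofFn fun i : Fin n => part m i + b i) anti.sortedGE_ofFn, ?_,
    fun i => ?_⟩
  · rw [← Nat.le_zero, ← not_lt, ← YoungDiagram.mem_iff_lt_rowLen, YoungDiagram.mem_ofRowLens]
    simp
  · simpa using YoungDiagram.rowLen_ofRowLens (hw := anti.sortedGE_ofFn) ⟨i, by simp⟩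

theorem addsBoxes_iff_part :
    AddsBoxes m.1 b nu.1 ↔ ∀ i : Fin n, part nu i + b (nodeN n) = part m i + b i := by
  refine ⟨fun h i => ?_, fun h i => ?_⟩
  · have : part nu i + (n - 1 - i) + b (nodeN n) = part m i + (n - 1 - i) + b i :=
      h.exponent_eq i
    omega
  · have := part_add_one m i
    have := part_add_one nu i
    have := h i
    have := h (i + 1)
    omega

namespace ExtendsBy

theorem isHorizontalStrip_iff (h : ExtendsBy lam m b) (h0 : b 0 = 0) :
    IsHorizontalStrip r lam (diagram m) ↔ ∑ i, b i = r ∧ ∀ i, b (i + 1) ≤ m.1 i := by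
  rw [SuFusion.isHorizontalStrip_iff, h.card_sdiff, and_iff_right h.diagram_le]
  simp only [rowLen_diagram]
  have row_iff (i : Fin n) (hi : i ≠ nodeN n) :
      lam.rowLen (i.1 + 1) ≤ part m i ↔ b (i + 1) ≤ m.1 i := by
    have := part_add_one m i
    rw [if_neg hi] at this
    rw [← val_add_one_of_ne_nodeN hi, h.2]
    omega
  refine and_congr_right fun _ => ⟨fun hb i => ?_, fun hb i => ?_⟩
  · obtain rfl | hi := eq_or_ne i (nodeN n)
    · simp only [nodeN_add_one, h0, Nat.zero_le]
    · exact (row_iff i hi).1 (hb i)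
  · rcases lt_or_ge (i + 1) n with hi | hi
    · exact (row_iff ⟨i, by omega⟩ (ne_nodeN_iff.2 hi)).2 (hb _)
    · simp only [rowLen_eq_zero_of_le h.1 hi, Nat.zero_le]

theorem represents_iff (h : ExtendsBy lam m b) (h0 : b 0 = 0) :
    Represents lam nu ↔ AddsBoxes m.1 b nu.1 := by
  have last : lam.rowLen (n - 1) = b (nodeN n) := by
    have := h.2 (nodeN n)
    rwa [part_nodeN, zero_add] at this
  have width : lam.rowLen 0 ≤ k := by
    have first := h.2 0
    have step := part_add_one m (nodeN n)
    rw [nodeN_add_one, part_nodeN, if_pos rfl, zero_add] at step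
    rw [h0, add_zero, Fin.val_zero] at *
    omega
  rw [Represents, and_iff_right (colLen_zero_le_iff.2 h.1), and_iff_right width, eq_iff_rowLen,
    addsBoxes_iff_part]
  simp only [rowLen_deleteColumns, rowLen_diagram, last]
  refine ⟨fun hrow i => ?_, fun hpart i => ?_⟩
  · have := lam.rowLen_anti i (n - 1) (Nat.le_sub_one_of_lt i.2)
    rw [← hrow, ← h.2]
    omega
  · rcases lt_or_ge i n with hi | hi
    · have := h.2 ⟨i, hi⟩
      have := hpart ⟨i, hi⟩
      dsimp only at *
      omega
    · simp only [rowLen_eq_zero_of_le h.1 hi, part_eq_zero_of_le nu (Nat.le_succ_of_le hi),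
        Nat.zero_sub]

end ExtendsBy

end Extensions

section Cases

variable {n k : ℕ} [NeZero n] {mu nu : Weight n k} {r : ℕ}

theorem columnCase1_iff : ColumnCase1 r mu nu ↔
    ∃ b ∈ verticalStrips mu.1 r, b 0 = 0 ∧ AddsBoxes mu.1 b nu.1 := by
  refine ⟨fun ⟨lam, represents, width, strip⟩ => ?_, fun ⟨b, strip, h0, adds⟩ => ?_⟩
  · obtain ⟨b, extends_by⟩ := exists_extendsBy_of_le represents.1 strip.1
    have h0 : b 0 = 0 := by simpa [rowLen_diagram, width] using extends_by.2 0
    have adds := (extends_by.represents_iff h0).1 represents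
    obtain ⟨sum_b, b_le⟩ := extends_by.isVerticalStrip_iff.1 strip
    exact ⟨b, mem_verticalStrips.2 ⟨sum_b, b_le, adds.addable⟩, h0, adds⟩
  · obtain ⟨sum_b, b_le, addable⟩ := mem_verticalStrips.1 strip
    obtain ⟨lam, extends_by⟩ := exists_extendsBy addable
    refine ⟨lam, (extends_by.represents_iff h0).2 adds, ?_,
      extends_by.isVerticalStrip_iff.2 ⟨sum_b, b_le⟩⟩
    simpa [rowLen_diagram, h0] using extends_by.2 0

theorem rowCase_iff : RowCase r mu nu ↔
    ∃ b ∈ horizontalStrips mu.1 r, b 0 = 0 ∧ AddsBoxes mu.1 b nu.1 := by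
  refine ⟨fun ⟨lam, represents, width, strip⟩ => ?_, fun ⟨b, strip, h0, adds⟩ => ?_⟩
  · obtain ⟨b, extends_by⟩ := exists_extendsBy_of_le represents.1 strip.1
    have h0 : b 0 = 0 := by simpa [rowLen_diagram, width] using extends_by.2 0
    exact ⟨b, mem_horizontalStrips.2 ((extends_by.isHorizontalStrip_iff h0).1 strip), h0,
      (extends_by.represents_iff h0).1 represents⟩
  · obtain ⟨lam, extends_by⟩ := exists_extendsBy adds.addable
    refine ⟨lam, (extends_by.represents_iff h0).2 adds, ?_,
      (extends_by.isHorizontalStrip_iff h0).2 (mem_horizontalStrips.1 strip)⟩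
    simpa [rowLen_diagram, h0] using extends_by.2 0

end Cases

section Wrapping

variable {n k : ℕ}

theorem phiStar_val (i : Fin n) (m : Weight n k) : (phiStar i m).1 = m.1 + Pi.single i 1 := by
  funext j
  by_cases hj : j = i <;> simp [phiStar, hj]

theorem phi_val_add_single (i : Fin n) (m : Weight n k) (h : 0 < m.1 i) :
    (phi i m h).1 + Pi.single i 1 = m.1 := by
  funext j
  obtain rfl | hj := eq_or_ne j i
  · simpa [phi] using Nat.sub_add_cancel h
  · simp [phi, hj]

variable [NeZero n] {m l a : Fin n → ℕ} {mu nu : Weight n k} {r : ℕ}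

theorem single_zero_add_one (i : Fin n) :
    (Pi.single 0 1 : Fin n → ℕ) (i + 1) = (Pi.single (nodeN n) 1 : Fin n → ℕ) i := by
  simp only [Pi.single_apply, add_one_eq_zero_iff]

theorem addsBoxes_boxes_add_single : AddsBoxes m (a + Pi.single 0 1) l ↔
    AddsBoxes (m + Pi.single 0 1) a (l + Pi.single (nodeN n) 1) := by
  refine forall_congr' fun i => ?_
  simp only [Pi.add_apply, single_zero_add_one]
  omega

theorem addsBoxes_add_single :
    AddsBoxes (m + Pi.single (nodeN n) 1) (a + Pi.single 0 1) (l + Pi.single 0 1) ↔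
      AddsBoxes m a l := by
  refine forall_congr' fun i => ?_
  simp only [Pi.add_apply, single_zero_add_one]
  omega

theorem add_single_mem_horizontalStrips :
    a + Pi.single 0 1 ∈ horizontalStrips (m + Pi.single (nodeN n) 1) (r + 1) ↔
      a ∈ horizontalStrips m r := by
  simp [mem_horizontalStrips, sum_add_distrib, single_zero_add_one]

theorem add_single_le_one_iff :
    (∀ i, (a + Pi.single 0 1 : Fin n → ℕ) i ≤ 1) ↔ (∀ i, a i ≤ 1) ∧ a 0 = 0 := by
  refine ⟨fun h => ⟨fun i => (Nat.le_add_right _ _).trans (h i), ?_⟩, fun ⟨h, h0⟩ i => ?_⟩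
  · simpa using h 0
  · obtain rfl | hi := eq_or_ne i 0
    · simp [h0]
    · simpa [hi] using h i

theorem exists_pos_apply_zero_iff {p : (Fin n → ℕ) → Prop} :
    (∃ b : Fin n → ℕ, 0 < b 0 ∧ p b) ↔ ∃ a : Fin n → ℕ, p (a + Pi.single 0 1) := by
  refine ⟨fun ⟨b, pos, hb⟩ => ⟨b - Pi.single 0 1, ?_⟩, fun ⟨a, ha⟩ => ⟨_, by simp, ha⟩⟩
  rwa [tsub_add_cancel_of_le]
  intro i
  obtain rfl | hi := eq_or_ne i 0 <;> simp [*, Nat.one_le_iff_ne_zero, pos.ne']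

theorem add_single_verticalStrip_iff :
    a + Pi.single 0 1 ∈ verticalStrips m (r + 1) ∧ AddsBoxes m (a + Pi.single 0 1) l ↔
      a ∈ verticalStrips (m + Pi.single 0 1) r ∧ a 0 = 0 ∧
        AddsBoxes (m + Pi.single 0 1) a (l + Pi.single (nodeN n) 1) := by
  have sum_eq : ∑ i, (a + Pi.single 0 1 : Fin n → ℕ) i = r + 1 ↔ ∑ i, a i = r := by
    simp [sum_add_distrib]
  rw [mem_verticalStrips, mem_verticalStrips, sum_eq, add_single_le_one_iff,
    addsBoxes_boxes_add_single]
  constructor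
  · rintro ⟨⟨sum_a, ⟨le_one, h0⟩, -⟩, adds⟩
    exact ⟨⟨sum_a, le_one, adds.addable⟩, h0, adds⟩
  · rintro ⟨⟨sum_a, le_one, -⟩, h0, adds⟩
    exact ⟨⟨sum_a, ⟨le_one, h0⟩, (addsBoxes_boxes_add_single.2 adds).addable⟩, adds⟩

theorem rowLen_zero_diagram_phiStar_node1 (hn : 2 ≤ n) :
    (diagram (phiStar (node1 n) mu)).rowLen 0 = (diagram mu).rowLen 0 + 1 := by
  have node1_mem : node1 n ∈ univ.filter fun j : Fin n => 0 ≤ j.1 ∧ j.1 + 1 < n := by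
    exact mem_filter.2 ⟨mem_univ _, Nat.zero_le _, hn⟩
  simp only [rowLen_diagram, part, phiStar_val, Pi.add_apply, sum_add_distrib, sum_pi_single',
    if_pos node1_mem]

theorem columnCase2_succ_iff (hn : 2 ≤ n) : ColumnCase2 (r + 1) mu nu ↔
    ColumnCase1 r (phiStar (node1 n) mu) (phiStar (nodeN n) nu) := by
  simp only [ColumnCase2, ColumnCase1, rowLen_zero_diagram_phiStar_node1 hn, add_left_inj,
    exists_eq_left]

theorem columnCase2_iff (hn : 2 ≤ n) : ColumnCase2 r mu nu ↔
    ∃ b, 0 < b 0 ∧ b ∈ verticalStrips mu.1 r ∧ AddsBoxes mu.1 b nu.1 := by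
  cases r with
  | zero =>
    refine iff_of_false (fun ⟨_, _, _, s, hs, _⟩ => s.succ_ne_zero hs) fun ⟨b, pos, strip, _⟩ => ?_
    have := (sum_eq_zero_iff.1 (mem_verticalStrips.1 strip).1) 0 (mem_univ _)
    exact pos.ne' this
  | succ r =>
    rw [columnCase2_succ_iff hn, columnCase1_iff, phiStar_val, phiStar_val,
      exists_pos_apply_zero_iff]
    exact exists_congr fun a => add_single_verticalStrip_iff.symm

theorem columnCase_iff (hn : 2 ≤ n) : ColumnCase1 r mu nu ∨ ColumnCase2 r mu nu ↔
    ∃ b ∈ verticalStrips mu.1 r, AddsBoxes mu.1 b nu.1 := by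
  rw [columnCase1_iff, columnCase2_iff hn, ← exists_or]
  refine exists_congr fun b => ?_
  rcases (b 0).eq_zero_or_pos with h0 | pos
  · simp [h0]
  · simp [pos, pos.ne']

theorem exists_horizontalStrip_iff_of_not_rowCase (h : ¬ RowCase r mu nu) :
    (∃ b ∈ horizontalStrips mu.1 r, AddsBoxes mu.1 b nu.1) ↔
      ∃ b, 0 < b 0 ∧ b ∈ horizontalStrips mu.1 r ∧ AddsBoxes mu.1 b nu.1 := by
  rw [rowCase_iff] at h
  push Not at h
  refine exists_congr fun b => (and_iff_right_of_imp fun ⟨strip, adds⟩ => ?_).symm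
  exact Nat.pos_of_ne_zero fun h0 => h b strip h0 adds

theorem exists_wrapping_horizontalStrip_iff (hmu : 0 < mu.1 (nodeN n))
    (hnu : 0 < nu.1 (node1 n)) :
    (∃ b, 0 < b 0 ∧ b ∈ horizontalStrips mu.1 (r + 1) ∧ AddsBoxes mu.1 b nu.1) ↔
      ∃ b ∈ horizontalStrips (phi (nodeN n) mu hmu).1 r,
        AddsBoxes (phi (nodeN n) mu hmu).1 b (phi (node1 n) nu hnu).1 := by
  have raise_mu := phi_val_add_single _ mu hmu
  have raise_nu : (phi (node1 n) nu hnu).1 + Pi.single 0 1 = nu.1 := phi_val_add_single _ nu hnu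
  refine exists_pos_apply_zero_iff.trans (exists_congr fun a => ?_)
  rw [← add_single_mem_horizontalStrips (m := (phi _ mu hmu).1),
    ← addsBoxes_add_single (m := (phi _ mu hmu).1), raise_mu, raise_nu]

theorem pos_of_wrapping_horizontalStrip {b : Fin n → ℕ} (pos : 0 < b 0)
    (strip : b ∈ horizontalStrips m r) (adds : AddsBoxes m b l) :
    0 < r ∧ 0 < m (nodeN n) ∧ 0 < l 0 := by
  obtain ⟨sum_b, b_le⟩ := mem_horizontalStrips.1 strip
  refine ⟨?_, ?_, ?_⟩
  · exact sum_b ▸ pos.trans_le (single_le_sum (fun _ _ => Nat.zero_le _) (mem_univ 0))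
  · exact pos.trans_le (nodeN_add_one (n := n) ▸ b_le (nodeN n))
  · have := b_le 0
    have := adds 0
    omega

end Wrapping

end SuFusion

theorem mainTheorem4 {n : ℕ} [NeZero n] (hn : 2 ≤ n) (k : ℕ) (mu nu : SuFusion.Weight n k) :
    (∀ (r : ℕ) (hr : r < n) (hk : r = 0 ∨ 0 < k),
      ((SuFusion.ColumnCase1 r mu nu ∨ SuFusion.ColumnCase2 r mu nu) →
        SuFusion.fusionCoeff (SuFusion.columnWeight n k r hr hk) mu nu = 1) ∧
      (¬ (SuFusion.ColumnCase1 r mu nu ∨ SuFusion.ColumnCase2 r mu nu) →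
        SuFusion.fusionCoeff (SuFusion.columnWeight n k r hr hk) mu nu = 0)) ∧
    (∀ (r : ℕ) (hr : r ≤ k),
      (SuFusion.RowCase r mu nu →
        SuFusion.fusionCoeff (SuFusion.rowWeight n k r hn hr) mu nu = 1) ∧
      (¬ SuFusion.RowCase r mu nu →
        (∀ (_ : 1 ≤ r) (hmu : 0 < mu.1 (SuFusion.nodeN n)) (hnu : 0 < nu.1 (SuFusion.node1 n)),
          SuFusion.fusionCoeff (SuFusion.rowWeight n k r hn hr) mu nu =
            SuFusion.fusionCoeff
              (SuFusion.rowWeight n (k - 1) (r - 1) hn (Nat.sub_le_sub_right hr 1))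
              (SuFusion.phi (SuFusion.nodeN n) mu hmu)
              (SuFusion.phi (SuFusion.node1 n) nu hnu)) ∧
        ((r = 0 ∨ mu.1 (SuFusion.nodeN n) = 0 ∨ nu.1 (SuFusion.node1 n) = 0) →
          SuFusion.fusionCoeff (SuFusion.rowWeight n k r hn hr) mu nu = 0))) := by
  open SuFusion in
  refine ⟨fun r hr hk => ?_, fun r hr => ⟨fun row => ?_, fun not_row => ?_⟩⟩
  · rw [columnCase_iff hn, fusionCoeff_columnWeight hr hk]
    exact ⟨fun h => if_pos h, fun h => if_neg h⟩
  · rw [fusionCoeff_rowWeight hn hr]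
    obtain ⟨b, strip, -, adds⟩ := rowCase_iff.1 row
    exact if_pos ⟨b, strip, adds⟩
  have wraps := exists_horizontalStrip_iff_of_not_rowCase not_row
  refine ⟨fun hr1 hmu hnu => ?_, fun hzero => ?_⟩
  · classical
    obtain ⟨s, rfl⟩ := Nat.exists_eq_add_of_le' hr1
    rw [fusionCoeff_rowWeight, fusionCoeff_rowWeight]
    exact if_congr (wraps.trans (exists_wrapping_horizontalStrip_iff hmu hnu)) rfl rfl
  · rw [fusionCoeff_rowWeight]
    refine if_neg fun h => ?_
    obtain ⟨b, pos, strip, adds⟩ := wraps.1 h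
    obtain ⟨hr0, hmu0, hnu0⟩ := pos_of_wrapping_horizontalStrip pos strip adds
    exact hzero.elim hr0.ne' (·.elim hmu0.ne' hnu0.ne')
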